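/- Let $d,m\ge 2$. For frequencies $\omega_1,\dots,\omega_m\in\mathbb{R}^d$ define the random Fourier and random Laplace feature vectors $$\phi_{\mathrm{RFF}}(x)=\tfrac{1}{\sqrt m}\big(\sin(\omega_i^\top x),\cos(\omega_i^\top x)\big)_{i=1}^m,\qquad \phi_{\mathrm{RLF}}(x)=\tfrac{1}{\sqrt m}\,e^{-\|x\|^2}\big(e^{\omega_i^\top x}\big)_{i=1}^m ,$$ and the kernel estimator $\widehat k(x,y)=\phi(x)^\top\phi(y)$. Split the $m$ frequencies into consecutive ensembles of $d$ frequencies (the last one possibly smaller; a single ensemble if $m\le d$). Random frequencies are called *orthogonal* if: frequencies of the same ensemble are almost surely mutually orthogonal; the joint law of the directions $\omega_i/\|\omega_i\|$ in each ensemble is invariant under rotations of $\mathbb{R}^d$; the directions of different ensembles are independent; every norm $\|\omega_i\|$ has the $\chi_d$ distribution; and the family of norms is independent of the family of directions. They have *independent norms* if moreover $\|\omega_1\|,\dots,\|\omega_m\|$ are independent. They are *pairwise norm-coupled* (PNC) if instead the frequencies of each ensemble are arranged in disjoint pairs, with at most one left over, such that almost surely $F_{\chi_d}(\|\omega_i\|)+F_{\chi_d}(\|\omega_j\|)=1$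 for each pair $\{i,j\}$, where $F_{\chi_d}$ is the CDF of $\chi_d$, and the norms of different pairs (and of the left-over frequencies) are independent. Then, for any $m\ge 2$, PNC frequencies give strictly lower (finite) kernel estimator variance than orthogonal frequencies with independent norms: 1. for RLFs, for all $x,y\in\mathbb{R}^d$ with $x+y\neq 0$; 2. for RFFs, whenever $0<z<\delta$, where $z=\|x-y\|_2$ and $\delta>0$ depends only on $d$. -/

import Mathlib

open MeasureTheory ProbabilityTheory

noncomputable section

/-- The chi distribution with `d` degrees of freedom: the law of the Euclidean norm of a standard
Gaussian vector of `ℝ^d`. -/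
def chi (d : ℕ) : Measure ℝ :=
  (stdGaussian (EuclideanSpace ℝ (Fin d))).map (fun g => ‖g‖)

/-- The random Fourier feature vector of `x` for the frequencies `ω_1, …, ω_m`: the concatenation of
the pairs `(sin (ω_iᵀ x), cos (ω_iᵀ x))`, scaled by `√(1/m)`. -/
def rffFeatures {d m : ℕ} (ω : Fin m → EuclideanSpace ℝ (Fin d)) (x : EuclideanSpace ℝ (Fin d)) :
    Fin m × Fin 2 → ℝ :=
  fun p => √(1 / (m : ℝ)) * ![Real.sin (inner ℝ (ω p.1) x), Real.cos (inner ℝ (ω p.1) x)] p.2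

/-- The random Laplace feature vector of `x` for the frequencies `ω_1, …, ω_m`. -/
def rlfFeatures {d m : ℕ} (ω : Fin m → EuclideanSpace ℝ (Fin d)) (x : EuclideanSpace ℝ (Fin d)) :
    Fin m → ℝ :=
  fun i => √(1 / (m : ℝ)) * Real.exp (-‖x‖ ^ 2) * Real.exp (inner ℝ (ω i) x)

/-- The kernel estimate `φ(x)ᵀ φ(y)` with random Fourier features. -/
def rffEstimator {d m : ℕ} (x y : EuclideanSpace ℝ (Fin d))
    (ω : Fin m → EuclideanSpace ℝ (Fin d)) : ℝ :=
  rffFeatures ω x ⬝ᵥ rffFeatures ω y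

/-- The kernel estimate `φ(x)ᵀ φ(y)` with random Laplace features. -/
def rlfEstimator {d m : ℕ} (x y : EuclideanSpace ℝ (Fin d))
    (ω : Fin m → EuclideanSpace ℝ (Fin d)) : ℝ :=
  rlfFeatures ω x ⬝ᵥ rlfFeatures ω y

/-- The direction `w / ‖w‖` of a frequency. -/
def direction {d : ℕ} (w : EuclideanSpace ℝ (Fin d)) : EuclideanSpace ℝ (Fin d) :=
  ‖w‖⁻¹ • w

/-- At most `d` vectors of `ℝ^d` can be mutually orthogonal, so `m` frequencies are split into
consecutive ensembles of `d` frequencies (the last one may be smaller); `ensemble i` is the number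
of the ensemble of the `i`-th frequency. If `m ≤ d`, there is only one ensemble. -/
def ensemble (d : ℕ) {m : ℕ} (i : Fin m) : ℕ := (i : ℕ) / d

/-- The directions of the frequencies of the `k`-th ensemble. -/
def ensembleDirections {d m : ℕ} {Ω : Type*} (ω : Fin m → Ω → EuclideanSpace ℝ (Fin d)) (k : ℕ)
    (a : Ω) : {i : Fin m // ensemble d i = k} → EuclideanSpace ℝ (Fin d) :=
  fun i => direction (ω i.1 a)

/-- `m` orthogonal random frequencies in `ℝ^d`, with an unspecified coupling of their norms. -/
structure IsOrthogonal {d m : ℕ} {Ω : Type*} [MeasurableSpace Ω] (μ : Measure Ω)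
    (ω : Fin m → Ω → EuclideanSpace ℝ (Fin d)) : Prop where
  measurable : ∀ i, Measurable (ω i)
  /-- The norms are marginally `χ_d`. -/
  norm_law : ∀ i, μ.map (fun a => ‖ω i a‖) = chi d
  /-- Distinct frequencies of the same ensemble are orthogonal. -/
  orthogonal : ∀ i j, i ≠ j → ensemble d i = ensemble d j →
    ∀ᵐ a ∂μ, inner ℝ (ω i a) (ω j a) = 0
  /-- The directions of an ensemble are jointly randomly rotated: their joint law is invariant
  under rotations of `ℝ^d`. -/
  rotation_invariant : ∀ (k : ℕ) (R : EuclideanSpace ℝ (Fin d) ≃ₗᵢ[ℝ] EuclideanSpace ℝ (Fin d)),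
    LinearMap.det (R.toLinearEquiv : EuclideanSpace ℝ (Fin d) →ₗ[ℝ] EuclideanSpace ℝ (Fin d)) = 1 →
      μ.map (fun a i => R (ensembleDirections ω k a i)) = μ.map (ensembleDirections ω k)
  /-- The directions of different ensembles are independent. -/
  indep_ensembles : iIndepFun (fun k : ℕ => ensembleDirections ω k) μ
  /-- The family of norms is independent of the family of directions. -/
  indep_norms_directions :
    IndepFun (fun a i => ‖ω i a‖) (fun a i => direction (ω i a)) μ

/-- `m` orthogonal random frequencies with independent norms. -/
structure IsOrthogonalIndepNorms {d m : ℕ} {Ω : Type*} [MeasurableSpace Ω] (μ : Measure Ω)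
    (ω : Fin m → Ω → EuclideanSpace ℝ (Fin d)) : Prop where
  isOrthogonal : IsOrthogonal μ ω
  indep_norms : iIndepFun (fun i a => ‖ω i a‖) μ

/-- An arrangement of the frequencies of every ensemble into pairs, at most one frequency of the
ensemble being left over: `τ i` is the partner of `i`, and `τ i = i` if `i` is left over. -/
structure IsPairing (d : ℕ) {m : ℕ} (τ : Fin m → Fin m) : Prop where
  involutive : Function.Involutive τ
  same_ensemble : ∀ i, ensemble d (τ i) = ensemble d i
  left_over : ∀ i j, τ i = i → τ j = j → ensemble d i = ensemble d j → i = j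

/-- `m` pairwise norm-coupled (PNC) orthogonal random frequencies. -/
structure IsPNC {d m : ℕ} {Ω : Type*} [MeasurableSpace Ω] (μ : Measure Ω)
    (ω : Fin m → Ω → EuclideanSpace ℝ (Fin d)) : Prop where
  isOrthogonal : IsOrthogonal μ ω
  /-- In every pair the norms are negative-monotone coupled; different pairs, listed by their
  smaller members, are independent (an unpaired frequency `i` is listed as `(i, i)`). -/
  coupled : ∃ τ : Fin m → Fin m, IsPairing d τ ∧
    (∀ i, τ i ≠ i → ∀ᵐ a ∂μ, cdf (chi d) ‖ω i a‖ + cdf (chi d) ‖ω (τ i) a‖ = 1) ∧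
    iIndepFun (fun (i : {i : Fin m // i ≤ τ i}) a => (‖ω i.1 a‖, ‖ω (τ i.1) a‖)) μ

end

/-! Both estimators are constants times a sum of `h ⟨ω i, v⟩`, with `h = exp`, `v = x + y` or `h =
cos`, `v = x - y`, so the variance is a sum of covariances. A single frequency has a uniform
direction and an independent `χ_d` norm in both models, so means and diagonal terms agree. Norms of
two frequencies that are not partners are independent in both models, so those covariances agree
too. Only partners differ.

Within an ensemble, `ω i ± ω j` has norm `√(r² + s²)` by orthogonality, and its direction is uniform
given the norms `r, s`. Hence the mixed moment is the mean of `K (r, s) = sphereMean d h (√(r² + s²)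
* ‖v‖)`, and the claim is that negative-monotone coupling lowers this mean below its value for
independent norms.

`IsNormCoupling.integral_lt` gives this for every strictly supermodular `K`, by comparing two
independent copies of the coupled pair after swapping second coordinates. For `exp`, symmetry
replaces `exp` by `cosh`, whose series in `r² + s²` has nonnegative coefficients, and `K` is
supermodular term by term. For `cos` the signs alternate, so small `z` is needed: the quadratic
terms have equal means, the quartic term favours the coupling by a fixed gap, and the sixth-order
remainder is negligible. The coupled law is unique (`IsNormCoupling.eq`), so the gap, and with it
`δ`, depends only on `d`. -/

noncomputable section

/-! ### The `χ_d` distribution: support, moments, distribution function. -/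

instance isProbabilityMeasure_chi (d : ℕ) : IsProbabilityMeasure (chi d) :=
  Measure.isProbabilityMeasure_map (by fun_prop)

lemma isOpenPosMeasure_stdGaussian (d : ℕ) :
    (stdGaussian (EuclideanSpace ℝ (Fin d))).IsOpenPosMeasure := by
  have : (gaussianReal 0 1).IsOpenPosMeasure :=
    (gaussianReal_absolutelyContinuous' 0 one_ne_zero).isOpenPosMeasure
  rw [← map_pi_eq_stdGaussian]
  exact (PiLp.continuous_toLp 2 _).isOpenPosMeasure_map (WithLp.toLp_surjective 2)

lemma stdGaussian_singleton {d : ℕ} (hd : 1 ≤ d) (x : EuclideanSpace ℝ (Fin d)) :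
    stdGaussian (EuclideanSpace ℝ (Fin d)) {x} = 0 := by
  have : NullSingletonClass (gaussianReal 0 1) := nullSingletonClass_gaussianReal one_ne_zero
  have : Nonempty (Fin d) := ⟨⟨0, hd⟩⟩
  rw [← map_pi_eq_stdGaussian, Measure.map_apply (by fun_prop) (measurableSet_singleton x)]
  have h : (WithLp.toLp 2 : (Fin d → ℝ) → EuclideanSpace ℝ (Fin d)) ⁻¹' {x} = {WithLp.ofLp x} := by
    ext y
    constructor
    · rintro rfl
      rfl
    · rintro rfl
      rfl
  rw [h]
  exact measure_singleton _

lemma chi_Iic_zero {d : ℕ} (hd : 1 ≤ d) : chi d (Set.Iic 0) = 0 := by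
  rw [chi, Measure.map_apply (by fun_prop) measurableSet_Iic]
  convert stdGaussian_singleton hd 0 using 2
  ext g
  simp

lemma ae_pos_chi {d : ℕ} (hd : 1 ≤ d) : ∀ᵐ r ∂(chi d), 0 < r := by
  rw [ae_iff]
  convert chi_Iic_zero hd using 2
  ext r
  simp

lemma chi_Ioo_pos {d : ℕ} (hd : 1 ≤ d) {a b : ℝ} (ha : 0 ≤ a) (hab : a < b) :
    0 < chi d (Set.Ioo a b) := by
  have := isOpenPosMeasure_stdGaussian d
  rw [chi, Measure.map_apply (by fun_prop) measurableSet_Ioo]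
  refine (isOpen_Ioo.preimage continuous_norm).measure_pos _ ?_
  refine ⟨EuclideanSpace.single ⟨0, hd⟩ ((a + b) / 2), ?_⟩
  have h : |(a + b) / 2| = (a + b) / 2 := abs_of_nonneg (by linarith)
  simp only [Set.mem_preimage, PiLp.norm_single, Real.norm_eq_abs, h, Set.mem_Ioo]
  constructor <;> linarith

lemma integrable_exp_mul_chi (d : ℕ) (c : ℝ) : Integrable (fun r => Real.exp (c * r)) (chi d) := by
  rw [chi, integrable_map_measure (by fun_prop) (by fun_prop)]
  obtain ⟨C, hC, h⟩ := IsGaussian.exists_integrable_exp_sq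
    (stdGaussian (EuclideanSpace ℝ (Fin d)))
  refine (h.const_mul (Real.exp (c ^ 2 / (4 * C)))).mono' (by fun_prop) (ae_of_all _ fun g => ?_)
  simp only [Function.comp, Real.norm_eq_abs, Real.abs_exp, ← Real.exp_add, Real.exp_le_exp]
  have : c ^ 2 / (4 * C) + C * ‖g‖ ^ 2 - c * ‖g‖ = (c - 2 * C * ‖g‖) ^ 2 / (4 * C) := by
    field_simp
    ring
  have : 0 ≤ (c - 2 * C * ‖g‖) ^ 2 / (4 * C) := by positivity
  linarith

lemma integrable_pow_chi (d k : ℕ) : Integrable (fun r => r ^ k) (chi d) := by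
  refine integrable_pow_of_integrable_exp_mul (X := fun r : ℝ => r) (t := 1) one_ne_zero ?_ ?_ k
  · exact integrable_exp_mul_chi d 1
  · exact integrable_exp_mul_chi d (-1)

lemma strictMonoOn_cdf_chi {d : ℕ} (hd : 1 ≤ d) : StrictMonoOn (cdf (chi d)) (Set.Ici 0) := by
  intro a ha b hb hab
  rw [cdf_eq_real, cdf_eq_real, ← sub_pos, ← measureReal_sdiff (Set.Iic_subset_Iic.2 hab.le) measurableSet_Iic,
    show Set.Iic b \ Set.Iic a = Set.Ioc a b by ext; simp [and_comm]]
  refine ENNReal.toReal_pos ?_ (measure_ne_top _ _)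
  exact ((chi_Ioo_pos hd ha hab).trans_le (measure_mono Set.Ioo_subset_Ioc_self)).ne'

/-! ### Rotations and uniformly distributed directions. -/

lemma det_reflection_orthogonal_singleton {d : ℕ} {u : EuclideanSpace ℝ (Fin d)} (hu : u ≠ 0) :
    LinearMap.det ((ℝ ∙ u)ᗮ.reflection.toLinearEquiv :
      EuclideanSpace ℝ (Fin d) →ₗ[ℝ] EuclideanSpace ℝ (Fin d)) = -1 := by
  have h := Submodule.det_reflection ((ℝ ∙ u)ᗮ)
  rw [Submodule.orthogonal_orthogonal, finrank_span_singleton hu, pow_one] at h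
  exact h

/-- The reflection exchanging `v` and `w` has determinant `-1`. Composing it with a reflection that
fixes `w`, along some `u ⊥ w`, restores determinant `1`; such a `u ≠ 0` exists because `d ≥ 2`. -/
lemma exists_rotation {d : ℕ} (hd : 2 ≤ d) {v w : EuclideanSpace ℝ (Fin d)} (h : ‖v‖ = ‖w‖) :
    ∃ R : EuclideanSpace ℝ (Fin d) ≃ₗᵢ[ℝ] EuclideanSpace ℝ (Fin d),
      LinearMap.det
        (R.toLinearEquiv : EuclideanSpace ℝ (Fin d) →ₗ[ℝ] EuclideanSpace ℝ (Fin d)) = 1 ∧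
      R v = w := by
  by_cases hvw : v = w
  · refine ⟨LinearIsometryEquiv.refl ℝ _, ?_, by simpa using hvw⟩
    exact LinearMap.det_id
  obtain ⟨u, hu, hu0⟩ : ∃ u ∈ (ℝ ∙ w)ᗮ, u ≠ 0 := by
    refine Submodule.exists_mem_ne_zero_of_ne_bot fun hbot => ?_
    have h1 := Submodule.finrank_add_finrank_orthogonal (ℝ ∙ w)
    have hw : w ≠ 0 := by
      rintro rfl
      exact hvw (by simpa using h)
    have h2 := finrank_span_singleton (K := ℝ) hw
    rw [hbot, finrank_bot, finrank_euclideanSpace_fin] at h1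
    omega
  refine ⟨((ℝ ∙ (v - w))ᗮ.reflection).trans ((ℝ ∙ u)ᗮ.reflection), ?_, ?_⟩
  · have h1 := det_reflection_orthogonal_singleton (sub_ne_zero.2 hvw)
    have h2 := det_reflection_orthogonal_singleton hu0
    have : ((((ℝ ∙ (v - w))ᗮ.reflection).trans ((ℝ ∙ u)ᗮ.reflection)).toLinearEquiv :
        EuclideanSpace ℝ (Fin d) →ₗ[ℝ] EuclideanSpace ℝ (Fin d)) =
        ((ℝ ∙ u)ᗮ.reflection.toLinearEquiv :
          EuclideanSpace ℝ (Fin d) →ₗ[ℝ] EuclideanSpace ℝ (Fin d)) ∘ₗ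
        ((ℝ ∙ (v - w))ᗮ.reflection.toLinearEquiv :
          EuclideanSpace ℝ (Fin d) →ₗ[ℝ] EuclideanSpace ℝ (Fin d)) := rfl
    rw [this, LinearMap.det_comp, h1, h2]
    norm_num
  · rw [LinearIsometryEquiv.trans_apply, Submodule.reflection_sub h,
      Submodule.reflection_mem_subspace_eq_self]
    rw [Submodule.mem_orthogonal_singleton_iff_inner_right] at hu ⊢
    rwa [real_inner_comm]

lemma measurable_direction (d : ℕ) : Measurable (direction (d := d)) := by
  unfold direction
  fun_prop

lemma norm_direction {d : ℕ} {w : EuclideanSpace ℝ (Fin d)} (hw : w ≠ 0) :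
    ‖direction w‖ = 1 := by
  rw [direction, norm_smul, norm_inv, norm_norm, inv_mul_cancel₀ (norm_ne_zero_iff.2 hw)]

lemma norm_direction_le {d : ℕ} (w : EuclideanSpace ℝ (Fin d)) : ‖direction w‖ ≤ 1 := by
  by_cases hw : w = 0
  · simp [direction, hw]
  · exact (norm_direction hw).le

lemma norm_smul_direction {d : ℕ} (w : EuclideanSpace ℝ (Fin d)) :
    ‖w‖ • direction w = w := by
  by_cases hw : w = 0
  · simp [direction, hw]
  · rw [direction, smul_smul, mul_inv_cancel₀ (norm_ne_zero_iff.2 hw), one_smul]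

lemma direction_map {d : ℕ} (R : EuclideanSpace ℝ (Fin d) ≃ₗᵢ[ℝ] EuclideanSpace ℝ (Fin d))
    (w : EuclideanSpace ℝ (Fin d)) : direction (R w) = R (direction w) := by
  simp [direction]

/-- The first coordinate of a uniformly random unit vector, as a function of a Gaussian vector. -/
def axisCos (d : ℕ) [NeZero d] (g : EuclideanSpace ℝ (Fin d)) : ℝ :=
  inner ℝ (EuclideanSpace.single 0 1) (direction g)

/-- The mean of `h (⟨v, U⟩)` for a uniformly random unit vector `U` and a vector `v` of
norm `t`. -/
def sphereMean (d : ℕ) [NeZero d] (h : ℝ → ℝ) (t : ℝ) : ℝ :=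
  ∫ g, h (t * axisCos d g) ∂(stdGaussian (EuclideanSpace ℝ (Fin d)))

lemma measurable_axisCos (d : ℕ) [NeZero d] : Measurable (axisCos d) := by
  have := measurable_direction d
  unfold axisCos
  fun_prop

lemma abs_axisCos_le (d : ℕ) [NeZero d] (g : EuclideanSpace ℝ (Fin d)) : |axisCos d g| ≤ 1 := by
  refine (abs_real_inner_le_norm _ _).trans ?_
  simpa using norm_direction_le g

/-- A rotation invariant random vector of constant norm is uniformly distributed on a sphere. -/
lemma integral_comp_inner_of_rotation_invariant {d : ℕ} [NeZero d] (hd : 2 ≤ d)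
    {ν : Measure (EuclideanSpace ℝ (Fin d))} [IsProbabilityMeasure ν]
    (hν : ∀ R : EuclideanSpace ℝ (Fin d) ≃ₗᵢ[ℝ] EuclideanSpace ℝ (Fin d),
      LinearMap.det
        (R.toLinearEquiv : EuclideanSpace ℝ (Fin d) →ₗ[ℝ] EuclideanSpace ℝ (Fin d)) = 1 →
      ν.map R = ν)
    {ρ : ℝ} (hρ0 : 0 ≤ ρ) (hρ : ∀ᵐ V ∂ν, ‖V‖ = ρ) {h : ℝ → ℝ} (hh : Continuous h)
    (v : EuclideanSpace ℝ (Fin d)) :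
    ∫ V, h (inner ℝ V v) ∂ν = sphereMean d h (ρ * ‖v‖) := by
  set γ := stdGaussian (EuclideanSpace ℝ (Fin d)) with hγ
  have hdir := measurable_direction d
  obtain ⟨C, hC⟩ := (isCompact_Icc (a := -(ρ * ‖v‖)) (b := ρ * ‖v‖)).exists_bound_of_continuousOn
    hh.continuousOn
  have hint : Integrable (Function.uncurry fun V g =>
      h (inner ℝ V (‖v‖ • direction g))) (ν.prod γ) := by
    refine Integrable.of_bound (C := C) (Measurable.aestronglyMeasurable ?_) ?_
    · refine hh.measurable.comp (Measurable.inner (by fun_prop) ?_)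
      exact (hdir.comp measurable_snd).const_smul ‖v‖
    · filter_upwards [Measure.quasiMeasurePreserving_fst.ae hρ] with p hp
      refine hC _ (abs_le.1 ((abs_real_inner_le_norm _ _).trans ?_))
      rw [hp, norm_smul, norm_norm]
      have := norm_direction_le p.2
      have := norm_nonneg v
      gcongr
      nlinarith
  -- The double integral over `V` and an independent uniform direction is evaluated in both orders.
  -- For fixed `V`, Gaussian invariance turns `V` into `ρ` times the first axis.
  have h1 : ∀ᵐ V ∂ν, ∫ g, h (inner ℝ V (‖v‖ • direction g)) ∂γ = sphereMean d h (ρ * ‖v‖) := by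
    filter_upwards [hρ] with V hV
    obtain ⟨R, -, hR⟩ := exists_rotation hd (v := V)
      (w := ρ • (EuclideanSpace.single (0 : Fin d) (1 : ℝ))) (by
        rw [norm_smul, hV, Real.norm_eq_abs, abs_of_nonneg hρ0]; simp)
    have hg : γ.map R = γ := stdGaussian_map R
    have hmeas := measurable_axisCos d
    have hgm : Measurable fun g => h (ρ * ‖v‖ * axisCos d g) :=
      hh.measurable.comp (hmeas.const_mul _)
    conv_rhs => rw [sphereMean, ← hγ, ← hg]
    rw [integral_map (by fun_prop) hgm.aestronglyMeasurable]
    congr with g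
    rw [axisCos, direction_map, ← R.inner_map_map V, hR, real_inner_smul_left, map_smul,
      real_inner_smul_right]
    ring_nf
  -- For fixed `g`, invariance of `ν` turns `‖v‖ • direction g` into `v`.
  have h2 : ∀ᵐ g ∂γ, ∫ V, h (inner ℝ V (‖v‖ • direction g)) ∂ν = ∫ V, h (inner ℝ V v) ∂ν := by
    have h0 : ∀ᵐ g ∂γ, g ≠ 0 := by
      rw [ae_iff]
      simpa using stdGaussian_singleton (by omega) (0 : EuclideanSpace ℝ (Fin d))
    filter_upwards [h0] with g hg
    obtain ⟨R, hR1, hR⟩ := exists_rotation hd (v := ‖v‖ • direction g) (w := v) (by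
      rw [norm_smul, norm_direction hg, norm_norm, mul_one])
    have hm : Measurable fun V => h (inner ℝ V v) := hh.measurable.comp (by fun_prop)
    conv_rhs => rw [← hν R hR1]
    rw [integral_map (by fun_prop) hm.aestronglyMeasurable]
    congr with V
    conv_rhs => rw [← hR, R.inner_map_map]
  have h3 := integral_integral_swap hint
  rw [integral_congr_ae h1, integral_congr_ae h2] at h3
  simpa using h3.symm

/-! ### Independence of vectors assembled from norms and directions. -/

/-- A finite measure on a product is spanned by a rectangle. -/
def finiteSpanningSetsInRectangles {α β : Type*} [MeasurableSpace α] [MeasurableSpace β]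
    (ν : Measure (α × β)) [IsFiniteMeasure ν] : ν.FiniteSpanningSetsIn
      (Set.image2 (· ×ˢ ·) {s : Set α | MeasurableSet s} {t : Set β | MeasurableSet t}) :=
  ⟨fun _ => Set.univ, fun _ => ⟨_, .univ, _, .univ, Set.univ_prod_univ⟩,
    fun _ => measure_lt_top _ _, Set.iUnion_const _⟩

/-- On rectangles, independence of the `X`s from the `Y`s separates the two families, and each
family then factors; rectangles determine the joint law. -/
lemma ProbabilityTheory.IndepFun.prodMk_prodMk_of_prod {Ω α β α' β' : Type*} [MeasurableSpace Ω]
    [MeasurableSpace α] [MeasurableSpace β] [MeasurableSpace α'] [MeasurableSpace β']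
    {μ : Measure Ω} [IsProbabilityMeasure μ] {X : Ω → α} {X' : Ω → α'} {Y : Ω → β} {Y' : Ω → β'}
    (hXX' : IndepFun X X' μ) (hX : Measurable X) (hX' : Measurable X') (hY : Measurable Y)
    (hY' : Measurable Y') (hYY' : IndepFun Y Y' μ)
    (hXY : IndepFun (fun a => (X a, X' a)) (fun a => (Y a, Y' a)) μ) :
    IndepFun (fun a => (X a, Y a)) (fun a => (X' a, Y' a)) μ := by
  have h1 : Measurable fun a => (X a, Y a) := hX.prodMk hY
  have h2 : Measurable fun a => (X' a, Y' a) := hX'.prodMk hY'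
  rw [indepFun_iff_map_prod_eq_prod_map_map h1.aemeasurable h2.aemeasurable]
  refine (Measure.prod_eq_generateFrom generateFrom_prod generateFrom_prod isPiSystem_prod
    isPiSystem_prod (finiteSpanningSetsInRectangles _) (finiteSpanningSetsInRectangles _) ?_).symm
  rintro _ ⟨A, hA, B, hB, rfl⟩ _ ⟨A', hA', B', hB', rfl⟩
  simp only [Set.mem_ofPred_eq] at hA hB hA' hB'
  have e1 := hXY.measure_inter_preimage_eq_mul _ _ (hA.prod hA') (hB.prod hB')
  have e2 := hXX'.measure_inter_preimage_eq_mul _ _ hA hA'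
  have e3 := hYY'.measure_inter_preimage_eq_mul _ _ hB hB'
  have e4 := (hXY.comp measurable_fst measurable_fst).measure_inter_preimage_eq_mul _ _ hA hB
  have e5 := (hXY.comp measurable_snd measurable_snd).measure_inter_preimage_eq_mul _ _ hA' hB'
  simp only [Set.mk_preimage_prod, Function.comp_def] at e1 e4 e5
  rw [Measure.map_apply (h1.prodMk h2) ((hA.prod hB).prod (hA'.prod hB')),
    Measure.map_apply h1 (hA.prod hB), Measure.map_apply h2 (hA'.prod hB')]
  simp only [Set.mk_preimage_prod]
  rw [e4, e5, Set.inter_inter_inter_comm, e1, e2, e3]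
  ring

/-! ### Projections of orthogonal frequencies. -/

namespace IsOrthogonal

variable {d m : ℕ} {Ω : Type*} [MeasurableSpace Ω] {μ : Measure Ω}
  {ω : Fin m → Ω → EuclideanSpace ℝ (Fin d)}

lemma ae_ne_zero (hω : IsOrthogonal μ ω) (hd : 1 ≤ d) (i : Fin m) : ∀ᵐ a ∂μ, ω i a ≠ 0 := by
  have h := ae_pos_chi hd
  rw [← hω.norm_law i] at h
  filter_upwards [ae_of_ae_map (hω.measurable i).norm.aemeasurable h] with a ha
  exact norm_pos_iff.1 ha

lemma measurable_ensembleDirections (hω : IsOrthogonal μ ω) (k : ℕ) :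
    Measurable (ensembleDirections ω k) :=
  measurable_pi_lambda _ fun i => (measurable_direction d).comp (hω.measurable i.1)

lemma measurable_norms (hω : IsOrthogonal μ ω) : Measurable fun a i => ‖ω i a‖ :=
  measurable_pi_lambda _ fun i => (hω.measurable i).norm

lemma integrable_comp_norm (hω : IsOrthogonal μ ω) (i : Fin m) {f : ℝ → ℝ}
    (hf : Integrable f (chi d)) : Integrable (fun a => f ‖ω i a‖) μ := by
  rw [← hω.norm_law i] at hf
  exact hf.comp_measurable (hω.measurable i).norm

lemma memLp_exp_inner (hω : IsOrthogonal μ ω) (i : Fin m) (v : EuclideanSpace ℝ (Fin d)) :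
    MemLp (fun a => Real.exp (inner ℝ (ω i a) v)) 2 μ := by
  have hm := hω.measurable i
  rw [memLp_two_iff_integrable_sq (by fun_prop)]
  refine (hω.integrable_comp_norm i (integrable_exp_mul_chi d (2 * ‖v‖))).mono' (by fun_prop)
    (ae_of_all _ fun a => ?_)
  rw [← Real.exp_nat_mul, Real.norm_eq_abs, Real.abs_exp, Real.exp_le_exp]
  have := real_inner_le_norm (ω i a) v
  push_cast
  linarith

lemma memLp_cos_inner [IsProbabilityMeasure μ] (hω : IsOrthogonal μ ω) (i : Fin m)
    (v : EuclideanSpace ℝ (Fin d)) :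
    MemLp (fun a => Real.cos (inner ℝ (ω i a) v)) 2 μ := by
  have hm := hω.measurable i
  exact MemLp.of_bound (by fun_prop) 1 (ae_of_all _ fun a => Real.abs_cos_le_one _)

/-- The mean of a function of a projection of a random vector whose direction is randomly rotated,
conditionally on the norms. -/
lemma integral_comp_inner [IsProbabilityMeasure μ] [NeZero d] (hω : IsOrthogonal μ ω) (hd : 2 ≤ d)
    (k : ℕ) {P : Type*} [MeasurableSpace P] {Z : (Fin m → ℝ) → P} (hZ : Measurable Z)
    {f : P → ({i : Fin m // ensemble d i = k} → EuclideanSpace ℝ (Fin d)) →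
      EuclideanSpace ℝ (Fin d)} (hf : Measurable (Function.uncurry f))
    (hfR : ∀ z (R : EuclideanSpace ℝ (Fin d) ≃ₗᵢ[ℝ] EuclideanSpace ℝ (Fin d)) q,
      f z (fun i => R (q i)) = R (f z q))
    {ρ : P → ℝ} (hρ0 : ∀ z, 0 ≤ ρ z)
    (hρ : ∀ z, ∀ᵐ a ∂μ, ‖f z (ensembleDirections ω k a)‖ = ρ z)
    {h : ℝ → ℝ} (hh : Continuous h) (v : EuclideanSpace ℝ (Fin d))
    (hint : Integrable
      (fun a => h (inner ℝ (f (Z fun i => ‖ω i a‖) (ensembleDirections ω k a)) v)) μ) :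
    ∫ a, h (inner ℝ (f (Z fun i => ‖ω i a‖) (ensembleDirections ω k a)) v) ∂μ =
      ∫ z, sphereMean d h (ρ z * ‖v‖) ∂(μ.map fun a => Z fun i => ‖ω i a‖) := by
  have hD := hω.measurable_ensembleDirections k
  have hN : Measurable fun a => Z fun i => ‖ω i a‖ := hZ.comp hω.measurable_norms
  have hind : IndepFun (fun a => Z fun i => ‖ω i a‖) (ensembleDirections ω k) μ :=
    hω.indep_norms_directions.comp
      (ψ := fun (u : Fin m → EuclideanSpace ℝ (Fin d)) (i : {i : Fin m // ensemble d i = k}) =>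
        u i.1) hZ (by fun_prop)
  have hmap := hind.map_prod_eq_prod_map_map hN.aemeasurable hD.aemeasurable
  have hF : Measurable fun p : P × ({i : Fin m // ensemble d i = k} → EuclideanSpace ℝ (Fin d)) =>
      h (inner ℝ (f p.1 p.2) v) := hh.measurable.comp (Measurable.inner hf (by fun_prop))
  have hND : Measurable fun a => (Z fun i => ‖ω i a‖, ensembleDirections ω k a) :=
    hN.prodMk hD
  have := Measure.isProbabilityMeasure_map (μ := μ) hN.aemeasurable
  have := Measure.isProbabilityMeasure_map (μ := μ) hD.aemeasurable
  have hint' := (integrable_map_measure (μ := μ) hF.aestronglyMeasurable hND.aemeasurable).2 hint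
  rw [hmap] at hint'
  have h1 := integral_map (μ := μ) hND.aemeasurable hF.aestronglyMeasurable
  rw [← h1, hmap, integral_prod _ hint']
  congr with z
  have hfz : Measurable (f z) := hf.comp measurable_prodMk_left
  have hg : Measurable fun V => h (inner ℝ V v) := hh.measurable.comp (by fun_prop)
  have := Measure.isProbabilityMeasure_map (μ := μ.map (ensembleDirections ω k)) hfz.aemeasurable
  rw [← integral_map (φ := f z) (f := fun V => h (inner ℝ V v)) hfz.aemeasurable
    hg.aestronglyMeasurable]
  -- With the norms frozen at `z`, the map `f z` commutes with rotations, so its image law inherits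
  -- the invariance of the directions.
  refine integral_comp_inner_of_rotation_invariant hd (fun R hR => ?_) (hρ0 z) ?_ hh v
  · have hRm : Measurable R := by fun_prop
    have hRm' : Measurable fun (q : {i : Fin m // ensemble d i = k} → EuclideanSpace ℝ (Fin d)) i =>
        R (q i) := by fun_prop
    rw [Measure.map_map hRm hfz]
    conv_rhs => rw [← hω.rotation_invariant k R hR]
    rw [Measure.map_map (hRm.comp hfz) hD, Measure.map_map hfz (g := f z)
      (f := fun a i => R (ensembleDirections ω k a i)) (hRm'.comp hD)]
    congr 1
    ext1 a
    exact (hfR z R _).symm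
  · rw [ae_map_iff hfz.aemeasurable (measurableSet_eq_fun (by fun_prop) (by fun_prop)),
      ae_map_iff hD.aemeasurable (measurableSet_eq_fun (by fun_prop) (by fun_prop))]
    exact hρ z

lemma integral_comp_inner_single [IsProbabilityMeasure μ] [NeZero d] (hω : IsOrthogonal μ ω)
    (hd : 2 ≤ d) (i : Fin m) {h : ℝ → ℝ} (hh : Continuous h) (v : EuclideanSpace ℝ (Fin d))
    (hint : Integrable (fun a => h (inner ℝ (ω i a) v)) μ) :
    ∫ a, h (inner ℝ (ω i a) v) ∂μ = ∫ r, sphereMean d h (|r| * ‖v‖) ∂(chi d) := by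
  have := hω.integral_comp_inner hd (ensemble d i) (Z := fun n => n i) (by fun_prop)
    (f := fun (z : ℝ) q => z • q ⟨i, rfl⟩) (by fun_prop) (by simp) (ρ := fun z => |z|)
    (fun z => abs_nonneg z) (fun z => ?_) hh v
    (by simpa only [ensembleDirections, norm_smul_direction] using hint)
  · simpa only [ensembleDirections, norm_smul_direction, hω.norm_law i] using this
  · filter_upwards [hω.ae_ne_zero (by omega) i] with a ha
    rw [norm_smul, ensembleDirections, norm_direction ha, mul_one, Real.norm_eq_abs]

/-- By Pythagoras the norm is `√(r² + s²)` for either sign `σ = ±1`; the minus sign serves the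
product formula for cosines. -/
lemma integral_comp_inner_pair [IsProbabilityMeasure μ] [NeZero d] (hω : IsOrthogonal μ ω)
    (hd : 2 ≤ d) {i j : Fin m} (hij : i ≠ j) (he : ensemble d i = ensemble d j) {σ : ℝ}
    (hσ : σ ^ 2 = 1) {h : ℝ → ℝ} (hh : Continuous h) (v : EuclideanSpace ℝ (Fin d))
    (hint : Integrable (fun a => h (inner ℝ (ω i a + σ • ω j a) v)) μ) :
    ∫ a, h (inner ℝ (ω i a + σ • ω j a) v) ∂μ =
      ∫ p, sphereMean d h (√(p.1 ^ 2 + p.2 ^ 2) * ‖v‖) ∂(μ.map fun a => (‖ω i a‖, ‖ω j a‖)) := by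
  have := hω.integral_comp_inner hd (ensemble d i) (Z := fun n => (n i, n j)) (by fun_prop)
    (f := fun (z : ℝ × ℝ) q => z.1 • q ⟨i, rfl⟩ + σ • z.2 • q ⟨j, he.symm⟩) (by fun_prop) (by simp)
    (ρ := fun z => √(z.1 ^ 2 + z.2 ^ 2))
    (fun z => Real.sqrt_nonneg _) (fun z => ?_) hh v
    (by simpa only [ensembleDirections, norm_smul_direction] using hint)
  · simpa only [ensembleDirections, norm_smul_direction] using this
  · filter_upwards [hω.ae_ne_zero (by omega) i, hω.ae_ne_zero (by omega) j,
      hω.orthogonal i j hij he] with a hi hj horth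
    have h0 : inner ℝ (direction (ω i a)) (direction (ω j a)) = 0 := by
      simp [direction, real_inner_smul_left, real_inner_smul_right, horth]
    rw [eq_comm, Real.sqrt_eq_iff_mul_self_eq (by positivity) (norm_nonneg _), ← sq,
      norm_add_sq_real]
    simp only [ensembleDirections, norm_smul, real_inner_smul_left, real_inner_smul_right, h0,
      norm_direction hi, norm_direction hj, mul_pow, Real.norm_eq_abs, sq_abs, hσ]
    ring

/-- Random projections of frequencies of different ensembles are uncorrelated if the norms are
independent. -/
lemma covariance_eq_zero [IsProbabilityMeasure μ] (hω : IsOrthogonal μ ω)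
    {i j : Fin m} (he : ensemble d i ≠ ensemble d j)
    (hind : IndepFun (fun a => ‖ω i a‖) (fun a => ‖ω j a‖) μ)
    {h : ℝ → ℝ} (hh : Continuous h) (v : EuclideanSpace ℝ (Fin d))
    (hint : ∀ i, MemLp (fun a => h (inner ℝ (ω i a) v)) 2 μ) :
    cov[fun a => h (inner ℝ (ω i a) v), fun a => h (inner ℝ (ω j a) v); μ] = 0 := by
  suffices hij : IndepFun (ω i) (ω j) μ by
    have hg : Measurable fun V => h (inner ℝ V v) := hh.measurable.comp (by fun_prop)
    exact (hij.comp hg hg).covariance_eq_zero (hint i) (hint j)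
  have hdir := measurable_direction d
  have hmi := hω.measurable i
  have hmj := hω.measurable j
  have hdirs : IndepFun (fun a => direction (ω i a)) (fun a => direction (ω j a)) μ :=
    (hω.indep_ensembles.indepFun he).comp
      (measurable_pi_apply (⟨i, rfl⟩ : {l : Fin m // ensemble d l = ensemble d i}))
      (measurable_pi_apply (⟨j, rfl⟩ : {l : Fin m // ensemble d l = ensemble d j}))
  have hnd : IndepFun (fun a => (‖ω i a‖, ‖ω j a‖))
      (fun a => (direction (ω i a), direction (ω j a))) μ :=
    hω.indep_norms_directions.comp (φ := fun n : Fin m → ℝ => (n i, n j))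
      (ψ := fun u : Fin m → EuclideanSpace ℝ (Fin d) => (u i, u j)) (by fun_prop) (by fun_prop)
  have := (hind.prodMk_prodMk_of_prod hmi.norm hmj.norm (hdir.comp hmi) (hdir.comp hmj) hdirs
    hnd).comp (φ := fun p : ℝ × EuclideanSpace ℝ (Fin d) => p.1 • p.2)
      (ψ := fun p : ℝ × EuclideanSpace ℝ (Fin d) => p.1 • p.2) (by fun_prop) (by fun_prop)
  simpa only [Function.comp_def, norm_smul_direction] using this

end IsOrthogonal

/-! ### Negative-monotone coupling of two norms. -/

/-- The law of a pair of negative-monotone coupled `χ_d` variables. -/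
structure IsNormCoupling (d : ℕ) (N : Measure (ℝ × ℝ)) : Prop where
  map_fst : N.map Prod.fst = chi d
  map_snd : N.map Prod.snd = chi d
  cdf_add_cdf : ∀ᵐ p ∂N, cdf (chi d) p.1 + cdf (chi d) p.2 = 1

namespace IsNormCoupling

variable {d : ℕ} {N N' : Measure (ℝ × ℝ)}

lemma isProbabilityMeasure (hN : IsNormCoupling d N) : IsProbabilityMeasure N := by
  constructor
  have h : N.map Prod.fst Set.univ = 1 := by rw [hN.map_fst, measure_univ]
  rwa [Measure.map_apply measurable_fst .univ] at h

lemma ae_pos (hN : IsNormCoupling d N) (hd : 1 ≤ d) : ∀ᵐ p ∂N, 0 < p.1 ∧ 0 < p.2 := by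
  have h1 := ae_pos_chi hd
  have h2 := h1
  rw [← hN.map_fst] at h1
  rw [← hN.map_snd] at h2
  filter_upwards [ae_of_ae_map measurable_fst.aemeasurable h1,
    ae_of_ae_map measurable_snd.aemeasurable h2] with p hp1 hp2 using ⟨hp1, hp2⟩

/-- Strict monotonicity of the distribution function on `[0, ∞)` makes the second norm a fixed
function of the first, whose law is prescribed. -/
lemma eq (hN : IsNormCoupling d N) (hN' : IsNormCoupling d N') (hd : 1 ≤ d) : N = N' := by
  classical
  have hF : Measurable (cdf (chi d)) := (monotone_cdf _).measurable
  have hmono := strictMonoOn_cdf_chi hd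
  -- The distribution function need only be injective on `[0, ∞)`. Using the identity on negative
  -- reals gives a globally injective measurable map, hence a measurable embedding with measurable
  -- left inverse `g`.
  set F : ℝ → ℝ := fun r => if 0 ≤ r then cdf (chi d) r else r with hFdef
  have hFm : Measurable F := Measurable.ite measurableSet_Ici hF measurable_id
  have hFi : Function.Injective F := by
    intro r s hrs
    simp only [hFdef] at hrs
    have := cdf_nonneg (chi d) r
    have := cdf_nonneg (chi d) s
    split_ifs at hrs with h1 h2 h2
    · exact hmono.injOn h1 h2 hrs
    · linarith
    · linarith
    · exact hrs
  obtain ⟨g, hg, hgF⟩ := (hFm.measurableEmbedding hFi).exists_measurable_extend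
    measurable_id (fun _ => inferInstance)
  have hT : Measurable fun r => (r, g (1 - cdf (chi d) r)) := by fun_prop
  have key : ∀ {N : Measure (ℝ × ℝ)}, IsNormCoupling d N →
      N = (chi d).map fun r => (r, g (1 - cdf (chi d) r)) := by
    intro N hN
    rw [← hN.map_fst, Measure.map_map (by rw [hN.map_fst]; exact hT) measurable_fst]
    conv_lhs => rw [← Measure.map_id (μ := N)]
    refine Measure.map_congr ?_
    filter_upwards [hN.ae_pos hd, hN.cdf_add_cdf] with p hp hp'
    have h : g (F p.2) = p.2 := congrFun hgF p.2
    simp only [hFdef, hp.2.le, if_true] at h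
    simp only [id, Function.comp, hN.map_fst]
    rw [← hp', add_sub_cancel_left, h]
  rw [key hN, key hN']

/-- Negative-monotone coupling strictly decreases the mean of a strictly supermodular function. -/
lemma integral_lt (hN : IsNormCoupling d N) (hd : 1 ≤ d) {K : ℝ × ℝ → ℝ} (hKm : Measurable K)
    (hKN : Integrable K N) (hK : Integrable K ((chi d).prod (chi d)))
    (hsup : ∀ r r' s s' : ℝ, 0 < r → r < r' → 0 < s → s < s' →
      K (r, s') + K (r', s) < K (r, s) + K (r', s')) :
    ∫ p, K p ∂N < ∫ p, K p ∂((chi d).prod (chi d)) := by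
  have := hN.isProbabilityMeasure
  have hmono := strictMonoOn_cdf_chi hd
  -- For two independent copies `(r, s)`, `(r', s')` of the coupled pair, the swapped pairs `(r,
  -- s')` and `(r', s)` have independent coordinates.
  have hC : MeasurePreserving (fun q : (ℝ × ℝ) × ℝ × ℝ => (q.1.1, q.2.2)) (N.prod N)
      ((chi d).prod (chi d)) := by
    have h := Measure.map_prod_map N N measurable_fst measurable_snd
    rw [hN.map_fst, hN.map_snd] at h
    exact ⟨by fun_prop, h.symm⟩
  have hD : MeasurePreserving (fun q : (ℝ × ℝ) × ℝ × ℝ => (q.2.1, q.1.2)) (N.prod N)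
      ((chi d).prod (chi d)) := hC.comp Measure.measurePreserving_swap
  have hA : MeasurePreserving Prod.fst (N.prod N) N := measurePreserving_fst
  have hB : MeasurePreserving Prod.snd (N.prod N) N := measurePreserving_snd
  have iA := hA.integrable_comp_of_integrable hKN
  have iB := hB.integrable_comp_of_integrable hKN
  have iC := hC.integrable_comp_of_integrable hK
  have iD := hD.integrable_comp_of_integrable hK
  have eq_int : ∀ {f : (ℝ × ℝ) × ℝ × ℝ → ℝ × ℝ} {M : Measure (ℝ × ℝ)},
      MeasurePreserving f (N.prod N) M → ∫ q, K (f q) ∂(N.prod N) = ∫ p, K p ∂M := by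
    intro f M hf
    rw [← hf.map_eq, integral_map hf.measurable.aemeasurable hKm.aestronglyMeasurable]
  have hpos := hN.ae_pos hd
  have hcdf := hN.cdf_add_cdf
  set G : (ℝ × ℝ) × ℝ × ℝ → ℝ := fun q =>
    K (q.1.1, q.2.2) + K (q.2.1, q.1.2) - (K q.1 + K q.2) with hG
  have hGint : Integrable G (N.prod N) := (iC.add iD).sub (iA.add iB)
  -- The coupling forces `s' < s` when `r < r'`, so supermodularity favours the swapped pairs.
  have hlt : ∀ r s r' s' : ℝ, 0 < r → 0 < s → 0 < r' → 0 < s' →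
      cdf (chi d) r + cdf (chi d) s = 1 → cdf (chi d) r' + cdf (chi d) s' = 1 → r < r' →
      K (r, s) + K (r', s') < K (r, s') + K (r', s) := by
    intro r s r' s' hr hs hr' hs' h h' hrr'
    have h1 := hmono (Set.mem_Ici.2 hr.le) (Set.mem_Ici.2 hr'.le) hrr'
    have h2 : s' < s := (hmono.lt_iff_lt (Set.mem_Ici.2 hs'.le) (Set.mem_Ici.2 hs.le)).1
      (by linarith)
    exact hsup r r' s' s hr hrr' hs' h2
  have hae : ∀ᵐ q ∂(N.prod N), 0 ≤ G q ∧ (q.1.1 < q.2.1 → 0 < G q) := by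
    filter_upwards [hA.quasiMeasurePreserving.ae hpos, hB.quasiMeasurePreserving.ae hpos,
      hA.quasiMeasurePreserving.ae hcdf, hB.quasiMeasurePreserving.ae hcdf]
    rintro ⟨⟨r, s⟩, r', s'⟩ ⟨hr, hs⟩ ⟨hr', hs'⟩ h h'
    simp only [hG] at *
    rcases lt_trichotomy r r' with hrr' | rfl | hrr'
    · have := hlt r s r' s' hr hs hr' hs' h h' hrr'
      exact ⟨by linarith, fun _ => by linarith⟩
    · have : s = s' := hmono.injOn (Set.mem_Ici.2 hs.le) (Set.mem_Ici.2 hs'.le) (by linarith)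
      subst this
      exact ⟨by linarith, fun h => absurd h (lt_irrefl _)⟩
    · have := hlt r' s' r s hr' hs' hr hs h' h hrr'
      exact ⟨by linarith, fun h => absurd h hrr'.not_gt⟩
  have hGpos : 0 < ∫ q, G q ∂(N.prod N) := by
    rw [integral_pos_iff_support_of_nonneg_ae (hae.mono fun q hq => hq.1) hGint]
    -- Strictness: the event `r < 1 < r'` has positive probability.
    have hset : 0 < (N.prod N) ((Prod.fst ⁻¹' Set.Ioo 0 1) ×ˢ (Prod.fst ⁻¹' Set.Ioo 1 2)) := by
      rw [Measure.prod_prod, ← Measure.map_apply measurable_fst measurableSet_Ioo,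
        ← Measure.map_apply measurable_fst measurableSet_Ioo, hN.map_fst]
      exact ENNReal.mul_pos (chi_Ioo_pos hd le_rfl one_pos).ne'
        (chi_Ioo_pos hd zero_le_one one_lt_two).ne'
    refine hset.trans_le (measure_mono_ae ?_)
    filter_upwards [hae] with q hq hmem
    obtain ⟨h1, h2⟩ := hmem
    exact (hq.2 (h1.2.trans h2.1)).ne'
  have hval : ∫ q, G q ∂(N.prod N) =
      ∫ p, K p ∂((chi d).prod (chi d)) + ∫ p, K p ∂((chi d).prod (chi d)) -
        (∫ p, K p ∂N + ∫ p, K p ∂N) := by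
    refine (integral_sub (iC.add iD) (iA.add iB)).trans (congrArg₂ _ ?_ ?_)
    · exact (integral_add iC iD).trans (congrArg₂ _ (eq_int hC) (eq_int hD))
    · exact (integral_add iA iB).trans (congrArg₂ _ (eq_int hA) (eq_int hB))
  linarith

end IsNormCoupling

/-! ### Supermodularity for Laplace features. -/

/-- Convexity of the power function in increment form; it yields the supermodularity of `(r² + s²) ^
k`. -/
lemma add_pow_sub_pow_le {x y p : ℝ} (hx : 0 ≤ x) (hxy : x ≤ y) (hp : 0 ≤ p) (k : ℕ) :
    (x + p) ^ k - x ^ k ≤ (y + p) ^ k - y ^ k := by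
  induction k with
  | zero => simp
  | succ k ih =>
    have h1 : (x + p) ^ (k + 1) - x ^ (k + 1) = (x + p) * ((x + p) ^ k - x ^ k) + p * x ^ k := by
      ring
    have h2 : (y + p) ^ (k + 1) - y ^ (k + 1) = (y + p) * ((y + p) ^ k - y ^ k) + p * y ^ k := by
      ring
    have h3 : 0 ≤ (x + p) ^ k - x ^ k := sub_nonneg.2 (by gcongr; linarith)
    rw [h1, h2]
    gcongr
    linarith

/-- `(r, s) ↦ cosh (√(r² + s²) c)` is strictly supermodular. -/
lemma cosh_sqrt_supermodular {r r' s s' c : ℝ} (hr : 0 < r) (hrr' : r < r') (hs : 0 < s)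
    (hss' : s < s') (hc : c ≠ 0) :
    Real.cosh (√(r ^ 2 + s' ^ 2) * c) + Real.cosh (√(r' ^ 2 + s ^ 2) * c) <
      Real.cosh (√(r ^ 2 + s ^ 2) * c) + Real.cosh (√(r' ^ 2 + s' ^ 2) * c) := by
  have hA : r ^ 2 < r' ^ 2 := by gcongr
  have hB : s ^ 2 < s' ^ 2 := by gcongr
  have hc2 : 0 < c ^ 2 := by positivity
  have hser : ∀ t : ℝ, 0 ≤ t →
      HasSum (fun n : ℕ => t ^ n * ((c ^ 2) ^ n / (2 * n).factorial)) (Real.cosh (√t * c)) := by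
    intro t ht
    convert Real.hasSum_cosh (√t * c) using 2 with n
    rw [mul_pow, pow_mul √t, Real.sq_sqrt ht, pow_mul c]
    ring
  -- The power series are compared term by term. The index `2` is the first with a mixed term, `2 r²
  -- s²`, which gives strictness.
  refine hasSum_lt (i := 2) (fun n => ?_) ?_
    ((hser (r ^ 2 + s' ^ 2) (by positivity)).add (hser (r' ^ 2 + s ^ 2) (by positivity)))
    ((hser (r ^ 2 + s ^ 2) (by positivity)).add (hser (r' ^ 2 + s' ^ 2) (by positivity)))
  · have h := add_pow_sub_pow_le (x := r ^ 2 + s ^ 2) (y := r' ^ 2 + s ^ 2) (p := s' ^ 2 - s ^ 2)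
      (by positivity) (by linarith) (by linarith) n
    rw [add_assoc, add_sub_cancel, add_assoc, add_sub_cancel] at h
    simp only [← add_mul]
    gcongr ?_ * _
    linarith
  · simp only [← add_mul]
    gcongr ?_ * _
    nlinarith [mul_pos (sub_pos.2 hA) (sub_pos.2 hB)]

section sphereMean

variable {d : ℕ} [NeZero d]

lemma measurable_sphereMean {h : ℝ → ℝ} (hh : Measurable h) : Measurable (sphereMean d h) := by
  have := measurable_axisCos d
  have hm : Measurable fun p : ℝ × EuclideanSpace ℝ (Fin d) => h (p.1 * axisCos d p.2) := by
    fun_prop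
  exact hm.stronglyMeasurable.integral_prod_right.measurable

lemma integrable_comp_mul_axisCos {h : ℝ → ℝ} (hh : Continuous h) (t : ℝ) :
    Integrable (fun g => h (t * axisCos d g)) (stdGaussian (EuclideanSpace ℝ (Fin d))) := by
  have := measurable_axisCos d
  obtain ⟨C, hC⟩ := (isCompact_Icc (a := -|t|) (b := |t|)).exists_bound_of_continuousOn
    hh.continuousOn
  refine Integrable.of_bound (C := C)
    (hh.measurable.comp (by fun_prop)).aestronglyMeasurable (ae_of_all _ fun g => ?_)
  refine hC _ (abs_le.1 ?_)
  rw [abs_mul]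
  exact mul_le_of_le_one_right (abs_nonneg t) (abs_axisCos_le d g)

/-- A uniform direction is symmetric under negation, so only the even part of `exp` contributes. -/
lemma sphereMean_exp (t : ℝ) : sphereMean d Real.exp t = sphereMean d Real.cosh t := by
  have hneg : sphereMean d Real.exp t = ∫ g, Real.exp (-(t * axisCos d g))
      ∂(stdGaussian (EuclideanSpace ℝ (Fin d))) := by
    have := measurable_axisCos d
    conv_lhs => rw [sphereMean, ← stdGaussian_map (LinearIsometryEquiv.neg ℝ)]
    rw [integral_map (by fun_prop) (by fun_prop)]
    congr with g
    rw [axisCos, direction_map]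
    simp [axisCos]
  have hcosh : sphereMean d Real.cosh t = ∫ g, (Real.exp (t * axisCos d g) +
      Real.exp (-(t * axisCos d g))) / 2 ∂(stdGaussian (EuclideanSpace ℝ (Fin d))) := by
    simp only [sphereMean, Real.cosh_eq]
  rw [hcosh, integral_div, integral_add (integrable_comp_mul_axisCos Real.continuous_exp t)
    (integrable_comp_mul_axisCos (h := fun x => Real.exp (-x)) (by fun_prop) t), ← hneg,
    ← sphereMean]
  ring

lemma abs_sphereMean_exp_le (t : ℝ) : |sphereMean d Real.exp t| ≤ Real.exp |t| := by
  have h := norm_integral_le_of_norm_le_const (C := Real.exp |t|) (f := fun g =>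
    Real.exp (t * axisCos d g)) (μ := stdGaussian (EuclideanSpace ℝ (Fin d)))
    (ae_of_all _ fun g => by
      rw [Real.norm_eq_abs, Real.abs_exp, Real.exp_le_exp]
      refine (le_abs_self _).trans ?_
      rw [abs_mul]
      exact mul_le_of_le_one_right (abs_nonneg t) (abs_axisCos_le d g))
  simpa [sphereMean] using h

lemma abs_sphereMean_cos_le (t : ℝ) : |sphereMean d Real.cos t| ≤ 1 := by
  have h := norm_integral_le_of_norm_le_const (C := 1) (f := fun g =>
    Real.cos (t * axisCos d g)) (μ := stdGaussian (EuclideanSpace ℝ (Fin d)))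
    (ae_of_all _ fun g => Real.abs_cos_le_one _)
  simpa [sphereMean] using h

variable (d) in
lemma measure_axisCos_ne_zero_pos :
    0 < stdGaussian (EuclideanSpace ℝ (Fin d)) {g | axisCos d g ≠ 0} := by
  have := isOpenPosMeasure_stdGaussian d
  have hopen : IsOpen {g : EuclideanSpace ℝ (Fin d) |
      inner ℝ (EuclideanSpace.single (0 : Fin d) (1 : ℝ)) g ≠ 0} :=
    isOpen_ne_fun (by fun_prop) (by fun_prop)
  refine (hopen.measure_pos _ ⟨EuclideanSpace.single (0 : Fin d) (1 : ℝ), by simp⟩).trans_le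
    (measure_mono fun g hg => ?_)
  have hg0 : g ≠ 0 := by
    rintro rfl
    simp at hg
  simp only [Set.mem_ofPred_eq, axisCos, direction, real_inner_smul_right]
  exact mul_ne_zero (inv_ne_zero (norm_ne_zero_iff.2 hg0)) hg

lemma integral_pos_of_axisCos {f : EuclideanSpace ℝ (Fin d) → ℝ}
    (hf : Integrable f (stdGaussian (EuclideanSpace ℝ (Fin d)))) (h0 : ∀ g, 0 ≤ f g)
    (hpos : ∀ g, axisCos d g ≠ 0 → 0 < f g) :
    0 < ∫ g, f g ∂(stdGaussian (EuclideanSpace ℝ (Fin d))) := by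
  rw [integral_pos_iff_support_of_nonneg h0 hf]
  exact (measure_axisCos_ne_zero_pos d).trans_le (measure_mono fun g hg => (hpos g hg).ne')

/-- The `cosh` inequality is integrated with `c = z * axisCos d g`. It degenerates to equality where
`axisCos` vanishes, but the complement has positive measure. -/
lemma sphereMean_exp_supermodular {r r' s s' z : ℝ} (hr : 0 < r) (hrr' : r < r') (hs : 0 < s)
    (hss' : s < s') (hz : 0 < z) :
    sphereMean d Real.exp (√(r ^ 2 + s' ^ 2) * z) + sphereMean d Real.exp (√(r' ^ 2 + s ^ 2) * z) <
      sphereMean d Real.exp (√(r ^ 2 + s ^ 2) * z) +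
        sphereMean d Real.exp (√(r' ^ 2 + s' ^ 2) * z) := by
  simp only [sphereMean_exp]
  have hi := fun t => integrable_comp_mul_axisCos (d := d) Real.continuous_cosh t
  have hlt : ∀ c : ℝ, c ≠ 0 → _ := fun c hc =>
    cosh_sqrt_supermodular hr hrr' hs hss' (mul_ne_zero hz.ne' hc)
  have := integral_pos_of_axisCos (((hi (√(r ^ 2 + s ^ 2) * z)).add
    (hi (√(r' ^ 2 + s' ^ 2) * z))).sub ((hi (√(r ^ 2 + s' ^ 2) * z)).add
    (hi (√(r' ^ 2 + s ^ 2) * z)))) (fun g => ?_) (fun g hg => ?_)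
  · rw [integral_sub' ((hi _).add (hi _)) ((hi _).add (hi _)), integral_add' (hi _) (hi _),
      integral_add' (hi _) (hi _)] at this
    simp only [sphereMean]
    linarith
  · by_cases hg : axisCos d g = 0
    · simp [hg]
    · have := hlt _ hg
      simp only [← mul_assoc] at this
      simp only [Pi.sub_apply, Pi.add_apply]
      linarith
  · have := hlt _ hg
    simp only [← mul_assoc] at this
    simp only [Pi.sub_apply, Pi.add_apply]
    linarith

end sphereMean

/-- Since `√(r² + s²) ≤ r + s ≤ 2 max r s`, the integrand is at most `exp (2 z r) + exp (2 z s)`, so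
the marginals suffice, whatever the coupling. -/
lemma integrable_sphereMean_exp {d : ℕ} [NeZero d] {M : Measure (ℝ × ℝ)}
    (h1 : MeasurePreserving Prod.fst M (chi d)) (h2 : MeasurePreserving Prod.snd M (chi d))
    (hpos : ∀ᵐ p ∂M, 0 < p.1 ∧ 0 < p.2) {z : ℝ} (hz : 0 ≤ z) :
    Integrable (fun p : ℝ × ℝ => sphereMean d Real.exp (√(p.1 ^ 2 + p.2 ^ 2) * z)) M := by
  have hm := measurable_sphereMean (d := d) Real.measurable_exp
  refine ((h1.integrable_comp_of_integrable (integrable_exp_mul_chi d (2 * z))).add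
    (h2.integrable_comp_of_integrable (integrable_exp_mul_chi d (2 * z)))).mono'
      (Measurable.aestronglyMeasurable (by fun_prop)) ?_
  filter_upwards [hpos] with p hp
  obtain ⟨hp1, hp2⟩ := hp
  refine (abs_sphereMean_exp_le _).trans ?_
  rw [abs_of_nonneg (by positivity)]
  simp only [Pi.add_apply, Function.comp_apply]
  have hsqrt : √(p.1 ^ 2 + p.2 ^ 2) ≤ p.1 + p.2 :=
    Real.sqrt_le_iff.2 ⟨by positivity, by nlinarith [mul_pos hp1 hp2]⟩
  rcases le_total p.1 p.2 with h | h
  · refine le_add_of_nonneg_of_le (Real.exp_nonneg _) (Real.exp_le_exp.2 ?_)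
    nlinarith
  · refine le_add_of_le_of_nonneg (Real.exp_le_exp.2 ?_) (Real.exp_nonneg _)
    nlinarith

lemma ae_pos_chi_prod {d : ℕ} (hd : 1 ≤ d) :
    ∀ᵐ p ∂((chi d).prod (chi d)), 0 < p.1 ∧ 0 < p.2 := by
  filter_upwards [Measure.quasiMeasurePreserving_fst.ae (ae_pos_chi hd),
    Measure.quasiMeasurePreserving_snd.ae (ae_pos_chi hd)] with p h1 h2 using ⟨h1, h2⟩

lemma IsNormCoupling.integral_sphereMean_exp_lt {d : ℕ} [NeZero d] {N : Measure (ℝ × ℝ)}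
    (hN : IsNormCoupling d N) (hd : 1 ≤ d) {z : ℝ} (hz : 0 < z) :
    ∫ p, sphereMean d Real.exp (√(p.1 ^ 2 + p.2 ^ 2) * z) ∂N <
      ∫ p, sphereMean d Real.exp (√(p.1 ^ 2 + p.2 ^ 2) * z) ∂((chi d).prod (chi d)) := by
  have hm := measurable_sphereMean (d := d) Real.measurable_exp
  refine hN.integral_lt hd (K := fun p => sphereMean d Real.exp (√(p.1 ^ 2 + p.2 ^ 2) * z))
    (by fun_prop) ?_ ?_ ?_
  · exact integrable_sphereMean_exp ⟨measurable_fst, hN.map_fst⟩ ⟨measurable_snd, hN.map_snd⟩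
      (hN.ae_pos hd) hz.le
  · exact integrable_sphereMean_exp measurePreserving_fst measurePreserving_snd
      (ae_pos_chi_prod hd) hz.le
  · intro r r' s s' hr hrr' hs hss'
    exact sphereMean_exp_supermodular hr hrr' hs hss' hz

/-! ### Small-distance expansion for Fourier features. -/

lemma nonneg_of_hasDerivAt_nonneg {f f' : ℝ → ℝ} (h0 : f 0 = 0)
    (hf : ∀ x, HasDerivAt f (f' x) x) (hf' : ∀ x, 0 ≤ x → 0 ≤ f' x) {x : ℝ} (hx : 0 ≤ x) :
    0 ≤ f x := by
  have hmono : MonotoneOn f (Set.Ici 0) :=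
    monotoneOn_of_hasDerivWithinAt_nonneg (convex_Ici 0)
      (fun y _ => (hf y).continuousAt.continuousWithinAt)
      (fun y _ => (hf y).hasDerivWithinAt)
      (fun y hy => hf' y (by simpa using (interior_subset hy)))
  rw [← h0]
  exact hmono Set.self_mem_Ici hx hx

/-- Start of a chain of Taylor bounds: each difference vanishes at `0`, and its derivative is the
difference from the preceding bound, here `x - x³/6 ≤ sin x`. -/
lemma cos_le_quartic (x : ℝ) : Real.cos x ≤ 1 - x ^ 2 / 2 + x ^ 4 / 24 := by
  wlog hx : 0 ≤ x generalizing x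
  · simpa [Even.neg_pow (show Even 4 by decide)] using this (-x) (by linarith)
  refine sub_nonneg.1 (nonneg_of_hasDerivAt_nonneg
    (f := fun x => 1 - x ^ 2 / 2 + x ^ 4 / 24 - Real.cos x)
    (f' := fun x => Real.sin x - (x - x ^ 3 / 6)) (by simp) (fun y => ?_) (fun y hy => ?_) hx)
  · refine ((((hasDerivAt_const y (1 : ℝ)).sub ((hasDerivAt_pow 2 y).div_const 2)).add
      ((hasDerivAt_pow 4 y).div_const 24)).sub (Real.hasDerivAt_cos y)).congr_deriv ?_
    push_cast
    ring
  · have := (abs_le.1 (Real.abs_sub_sin_le y)).2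
    rw [abs_of_nonneg hy] at this
    linarith

lemma sin_le_quintic {x : ℝ} (hx : 0 ≤ x) : Real.sin x ≤ x - x ^ 3 / 6 + x ^ 5 / 120 := by
  refine sub_nonneg.1 (nonneg_of_hasDerivAt_nonneg
    (f := fun x => x - x ^ 3 / 6 + x ^ 5 / 120 - Real.sin x)
    (f' := fun x => 1 - x ^ 2 / 2 + x ^ 4 / 24 - Real.cos x) (by simp) (fun y => ?_)
    (fun y _ => sub_nonneg.2 (cos_le_quartic y)) hx)
  refine ((((hasDerivAt_id y).sub ((hasDerivAt_pow 3 y).div_const 6)).add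
      ((hasDerivAt_pow 5 y).div_const 120)).sub (Real.hasDerivAt_sin y)).congr_deriv ?_
  push_cast
  ring

lemma sextic_le_cos (x : ℝ) : 1 - x ^ 2 / 2 + x ^ 4 / 24 - x ^ 6 / 720 ≤ Real.cos x := by
  wlog hx : 0 ≤ x generalizing x
  · simpa [Even.neg_pow (show Even 4 by decide), Even.neg_pow (show Even 6 by decide)]
      using this (-x) (by linarith)
  refine sub_nonneg.1 (nonneg_of_hasDerivAt_nonneg
    (f := fun x => Real.cos x - (1 - x ^ 2 / 2 + x ^ 4 / 24 - x ^ 6 / 720))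
    (f' := fun x => x - x ^ 3 / 6 + x ^ 5 / 120 - Real.sin x) (by simp) (fun y => ?_)
    (fun y hy => sub_nonneg.2 (sin_le_quintic hy)) hx)
  refine ((Real.hasDerivAt_cos y).sub
    ((((hasDerivAt_const y (1 : ℝ)).sub ((hasDerivAt_pow 2 y).div_const 2)).add
      ((hasDerivAt_pow 4 y).div_const 24)).sub
        ((hasDerivAt_pow 6 y).div_const 720))).congr_deriv ?_
  push_cast
  ring

lemma integrable_sq_add_sq_pow {d : ℕ} {M : Measure (ℝ × ℝ)}
    (h1 : MeasurePreserving Prod.fst M (chi d)) (h2 : MeasurePreserving Prod.snd M (chi d))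
    (k : ℕ) : Integrable (fun p : ℝ × ℝ => (p.1 ^ 2 + p.2 ^ 2) ^ k) M := by
  refine (((h1.integrable_comp_of_integrable (integrable_pow_chi d (2 * k))).add
    (h2.integrable_comp_of_integrable (integrable_pow_chi d (2 * k)))).const_mul
      (2 ^ (k - 1))).mono' (Measurable.aestronglyMeasurable (by fun_prop)) (ae_of_all _ fun p => ?_)
  rw [Real.norm_eq_abs, abs_of_nonneg (by positivity)]
  simpa only [Pi.add_apply, Function.comp_apply, pow_mul] using
    add_pow_le (sq_nonneg p.1) (sq_nonneg p.2) k

/-- The quadratic term is blind to the coupling, so it cancels in the comparison. -/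
lemma integral_sq_add_sq {d : ℕ} {M : Measure (ℝ × ℝ)}
    (h1 : MeasurePreserving Prod.fst M (chi d)) (h2 : MeasurePreserving Prod.snd M (chi d)) :
    ∫ p, (p.1 ^ 2 + p.2 ^ 2) ∂M = 2 * ∫ r, r ^ 2 ∂(chi d) := by
  have hi := integrable_pow_chi d 2
  have e1 : ∫ p : ℝ × ℝ, p.1 ^ 2 ∂M = ∫ r, r ^ 2 ∂(chi d) := by
    rw [← h1.map_eq, integral_map (by fun_prop) (by fun_prop)]
  have e2 : ∫ p : ℝ × ℝ, p.2 ^ 2 ∂M = ∫ r, r ^ 2 ∂(chi d) := by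
    rw [← h2.map_eq, integral_map (by fun_prop) (by fun_prop)]
  have i1 : Integrable (fun p : ℝ × ℝ => p.1 ^ 2) M := h1.integrable_comp_of_integrable hi
  have i2 : Integrable (fun p : ℝ × ℝ => p.2 ^ 2) M := h2.integrable_comp_of_integrable hi
  rw [integral_add i1 i2, e1, e2, two_mul]

section sphereMean

variable {d : ℕ} [NeZero d]

variable (d) in
/-- The `k`-th moment of a coordinate of a uniformly random unit vector. -/
def axisMoment (k : ℕ) : ℝ := ∫ g, axisCos d g ^ k ∂(stdGaussian (EuclideanSpace ℝ (Fin d)))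

lemma integrable_axisCos_pow (k : ℕ) :
    Integrable (fun g => axisCos d g ^ k) (stdGaussian (EuclideanSpace ℝ (Fin d))) := by
  simpa using integrable_comp_mul_axisCos (d := d) (h := fun x => x ^ k) (by fun_prop) 1

lemma axisMoment_four_pos : 0 < axisMoment d 4 :=
  integral_pos_of_axisCos (integrable_axisCos_pow 4) (fun g => by positivity)
    (fun g hg => by positivity)

lemma axisMoment_six_nonneg : 0 ≤ axisMoment d 6 :=
  integral_nonneg fun g => by positivity

lemma integral_quartic (t : ℝ) :
    ∫ g, (1 - (t * axisCos d g) ^ 2 / 2 + (t * axisCos d g) ^ 4 / 24)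
      ∂(stdGaussian (EuclideanSpace ℝ (Fin d))) =
      1 - t ^ 2 * axisMoment d 2 / 2 + t ^ 4 * axisMoment d 4 / 24 := by
  simp only [mul_pow]
  have i2 := ((integrable_axisCos_pow (d := d) 2).const_mul (t ^ 2)).div_const 2
  have i4 := ((integrable_axisCos_pow (d := d) 4).const_mul (t ^ 4)).div_const 24
  have i02 : Integrable (fun g => 1 - t ^ 2 * axisCos d g ^ 2 / 2)
    (stdGaussian (EuclideanSpace ℝ (Fin d))) := (integrable_const 1).sub i2
  rw [integral_add i02 i4, integral_sub (integrable_const 1) i2]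
  simp [integral_div, integral_const_mul, axisMoment]

lemma sphereMean_cos_le (t : ℝ) : sphereMean d Real.cos t ≤
    1 - t ^ 2 * axisMoment d 2 / 2 + t ^ 4 * axisMoment d 4 / 24 := by
  rw [← integral_quartic]
  exact integral_mono (integrable_comp_mul_axisCos Real.continuous_cos t)
    (integrable_comp_mul_axisCos (h := fun x => 1 - x ^ 2 / 2 + x ^ 4 / 24) (by fun_prop) t)
    fun g => cos_le_quartic _

lemma le_sphereMean_cos (t : ℝ) :
    1 - t ^ 2 * axisMoment d 2 / 2 + t ^ 4 * axisMoment d 4 / 24 - t ^ 6 * axisMoment d 6 / 720 ≤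
      sphereMean d Real.cos t := by
  have h6 : t ^ 6 * axisMoment d 6 / 720 = ∫ g, (t * axisCos d g) ^ 6 / 720
      ∂(stdGaussian (EuclideanSpace ℝ (Fin d))) := by
    simp only [mul_pow]
    rw [integral_div, integral_const_mul, axisMoment]
  rw [← integral_quartic, h6, ← integral_sub
    (integrable_comp_mul_axisCos (h := fun x => 1 - x ^ 2 / 2 + x ^ 4 / 24) (by fun_prop) t)
    (integrable_comp_mul_axisCos (h := fun x => x ^ 6 / 720) (by fun_prop) t)]
  exact integral_mono
    (integrable_comp_mul_axisCos
      (h := fun x => 1 - x ^ 2 / 2 + x ^ 4 / 24 - x ^ 6 / 720) (by fun_prop) t)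
    (integrable_comp_mul_axisCos Real.continuous_cos t) fun g => sextic_le_cos _

lemma integrable_sphereMean_cos {M : Measure (ℝ × ℝ)} [IsFiniteMeasure M] (z : ℝ) :
    Integrable (fun p : ℝ × ℝ => sphereMean d Real.cos (√(p.1 ^ 2 + p.2 ^ 2) * z)) M := by
  have hm := measurable_sphereMean (d := d) Real.measurable_cos
  exact Integrable.of_bound (C := 1) (Measurable.aestronglyMeasurable (by fun_prop))
    (ae_of_all _ fun p => abs_sphereMean_cos_le _)

end sphereMean

lemma sqrt_mul_pow_even (p : ℝ × ℝ) (z : ℝ) (k : ℕ) :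
    (√(p.1 ^ 2 + p.2 ^ 2) * z) ^ (2 * k) = (p.1 ^ 2 + p.2 ^ 2) ^ k * z ^ (2 * k) := by
  rw [mul_pow, pow_mul √_, Real.sq_sqrt (by positivity)]

lemma integral_quartic_sqrt {d : ℕ} {M : Measure (ℝ × ℝ)} [IsProbabilityMeasure M]
    (h1 : MeasurePreserving Prod.fst M (chi d)) (h2 : MeasurePreserving Prod.snd M (chi d))
    (z a b : ℝ) :
    Integrable (fun p : ℝ × ℝ => 1 - (√(p.1 ^ 2 + p.2 ^ 2) * z) ^ 2 * a / 2 +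
      (√(p.1 ^ 2 + p.2 ^ 2) * z) ^ 4 * b / 24) M ∧
    ∫ p, (1 - (√(p.1 ^ 2 + p.2 ^ 2) * z) ^ 2 * a / 2 +
      (√(p.1 ^ 2 + p.2 ^ 2) * z) ^ 4 * b / 24) ∂M =
      1 - (2 * ∫ r, r ^ 2 ∂(chi d)) * z ^ 2 * a / 2 +
        (∫ p, (p.1 ^ 2 + p.2 ^ 2) ^ 2 ∂M) * z ^ 4 * b / 24 := by
  have e : ∀ p : ℝ × ℝ, 1 - (√(p.1 ^ 2 + p.2 ^ 2) * z) ^ 2 * a / 2 +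
      (√(p.1 ^ 2 + p.2 ^ 2) * z) ^ 4 * b / 24 = 1 - (p.1 ^ 2 + p.2 ^ 2) * (z ^ 2 * a / 2) +
        (p.1 ^ 2 + p.2 ^ 2) ^ 2 * (z ^ 4 * b / 24) := by
    intro p
    have e2 := sqrt_mul_pow_even p z 1
    have e4 := sqrt_mul_pow_even p z 2
    norm_num at e2 e4
    rw [e2, e4]
    ring
  have i1 : Integrable (fun p : ℝ × ℝ => (p.1 ^ 2 + p.2 ^ 2) * (z ^ 2 * a / 2)) M := by
    simpa using (integrable_sq_add_sq_pow h1 h2 1).mul_const (z ^ 2 * a / 2)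
  have i2 := (integrable_sq_add_sq_pow h1 h2 2).mul_const (z ^ 4 * b / 24)
  simp only [e]
  have i01 : Integrable (fun p : ℝ × ℝ => 1 - (p.1 ^ 2 + p.2 ^ 2) * (z ^ 2 * a / 2)) M :=
    (integrable_const 1).sub i1
  refine ⟨i01.add i2, ?_⟩
  rw [integral_add i01 i2, integral_sub (integrable_const 1) i1,
    integral_mul_const, integral_mul_const, integral_sq_add_sq h1 h2]
  simp
  ring

/-- The gap of the fourth moments of `√(r² + s²)` for independent and coupled norms depends only
on the dimension. -/
lemma exists_moment_gap {d : ℕ} (hd : 1 ≤ d) : ∃ κ : ℝ, 0 < κ ∧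
    ∀ N : Measure (ℝ × ℝ), IsNormCoupling d N →
      ∫ p, (p.1 ^ 2 + p.2 ^ 2) ^ 2 ∂N + κ =
        ∫ p, (p.1 ^ 2 + p.2 ^ 2) ^ 2 ∂((chi d).prod (chi d)) := by
  by_cases h : ∃ N, IsNormCoupling d N
  · obtain ⟨N, hN⟩ := h
    refine ⟨∫ p, (p.1 ^ 2 + p.2 ^ 2) ^ 2 ∂((chi d).prod (chi d)) -
      ∫ p, (p.1 ^ 2 + p.2 ^ 2) ^ 2 ∂N, sub_pos.2 ?_, fun N' hN' => ?_⟩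
    · refine hN.integral_lt hd (K := fun p => (p.1 ^ 2 + p.2 ^ 2) ^ 2) (by fun_prop)
        (integrable_sq_add_sq_pow ⟨measurable_fst, hN.map_fst⟩ ⟨measurable_snd, hN.map_snd⟩ 2)
        (integrable_sq_add_sq_pow measurePreserving_fst measurePreserving_snd 2) ?_
      intro r r' s s' hr hrr' hs hss'
      have hA : r ^ 2 < r' ^ 2 := by gcongr
      have hB : s ^ 2 < s' ^ 2 := by gcongr
      nlinarith [mul_pos (sub_pos.2 hA) (sub_pos.2 hB)]
    · rw [hN'.eq hN hd]
      ring
  -- Without any coupling the claim is vacuous.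
  · exact ⟨1, one_pos, fun N hN => absurd ⟨N, hN⟩ h⟩

/-- The quartic upper bound for the coupled norms is set against the sextic lower bound for the
independent ones; the gap `κ` of order `z⁴` beats the remainder of order `z⁶`. -/
lemma exists_integral_sphereMean_cos_lt {d : ℕ} [NeZero d] (hd : 1 ≤ d) : ∃ δ : ℝ, 0 < δ ∧
    ∀ N : Measure (ℝ × ℝ), IsNormCoupling d N → ∀ z : ℝ, 0 < z → z < δ →
      ∫ p, sphereMean d Real.cos (√(p.1 ^ 2 + p.2 ^ 2) * z) ∂N <
        ∫ p, sphereMean d Real.cos (√(p.1 ^ 2 + p.2 ^ 2) * z) ∂((chi d).prod (chi d)) := by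
  obtain ⟨κ, hκ, hgap⟩ := exists_moment_gap hd
  set B := ∫ p, (p.1 ^ 2 + p.2 ^ 2) ^ 3 ∂((chi d).prod (chi d)) with hB
  have hB0 : 0 ≤ B := integral_nonneg fun p => by positivity
  have h4 := axisMoment_four_pos (d := d)
  have h6 := axisMoment_six_nonneg (d := d)
  -- The remainder requires `z² * (B * axisMoment d 6 / 720) < κ * axisMoment d 4 / 24`. The bound
  -- `1` gives `z² ≤ z`, and the added `1` keeps the denominator positive.
  refine ⟨min 1 ((κ * axisMoment d 4 / 24) / (B * axisMoment d 6 / 720 + 1)), by positivity, ?_⟩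
  intro N hN z hz hzδ
  obtain ⟨hz1, hz2⟩ := lt_min_iff.1 hzδ
  rw [lt_div_iff₀ (by positivity)] at hz2
  have := hN.isProbabilityMeasure
  have hi3 : Integrable (fun p : ℝ × ℝ => (√(p.1 ^ 2 + p.2 ^ 2) * z) ^ 6 * axisMoment d 6 / 720)
      ((chi d).prod (chi d)) := by
    have e6 := fun p : ℝ × ℝ => sqrt_mul_pow_even p z 3
    norm_num at e6
    simp only [e6]
    exact (((integrable_sq_add_sq_pow measurePreserving_fst measurePreserving_snd 3).mul_const
      _).mul_const _).div_const _
  have hv3 : ∫ p : ℝ × ℝ, (√(p.1 ^ 2 + p.2 ^ 2) * z) ^ 6 * axisMoment d 6 / 720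
      ∂((chi d).prod (chi d)) = B * z ^ 6 * axisMoment d 6 / 720 := by
    have e6 := fun p : ℝ × ℝ => sqrt_mul_pow_even p z 3
    norm_num at e6
    simp only [e6]
    rw [integral_div, integral_mul_const, integral_mul_const]
  obtain ⟨iN, vN⟩ := integral_quartic_sqrt (M := N) ⟨measurable_fst, hN.map_fst⟩
    ⟨measurable_snd, hN.map_snd⟩ z (axisMoment d 2) (axisMoment d 4)
  obtain ⟨iP, vP⟩ := integral_quartic_sqrt (d := d) measurePreserving_fst measurePreserving_snd z
    (axisMoment d 2) (axisMoment d 4)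
  have hupper := integral_mono (integrable_sphereMean_cos (d := d) z) iN
    fun p => sphereMean_cos_le _
  have hlower := integral_mono (iP.sub hi3) (integrable_sphereMean_cos (d := d) z)
    fun p => le_sphereMean_cos _
  rw [integral_sub' iP hi3, vP, hv3, ← hgap N hN] at hlower
  rw [vN] at hupper
  refine hupper.trans_lt (lt_of_lt_of_le ?_ hlower)
  have hkey : z ^ 4 * (z ^ 2 * (B * axisMoment d 6 / 720)) < z ^ 4 * (κ * axisMoment d 4 / 24) := by
    gcongr
    have hc : 0 ≤ B * axisMoment d 6 / 720 := by positivity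
    nlinarith [mul_nonneg (mul_nonneg hz.le hc) (sub_nonneg.2 hz1.le)]
  linarith

/-! ### Comparison of the variances, covariance by covariance. -/

section comparison

variable {d m : ℕ} {Ω Ω' : Type*} [MeasurableSpace Ω] [MeasurableSpace Ω'] {μ : Measure Ω}
  {μ' : Measure Ω'} {ω : Fin m → Ω → EuclideanSpace ℝ (Fin d)}
  {ω' : Fin m → Ω' → EuclideanSpace ℝ (Fin d)}

/-- Each norm is a coordinate of the pair listed by its smaller member; frequencies that are neither
equal nor partners belong to different pairs. -/
lemma IsPairing.indepFun_norm {τ : Fin m → Fin m} (hτ : IsPairing d τ)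
    (hind : iIndepFun (fun (i : {i : Fin m // i ≤ τ i}) a => (‖ω i.1 a‖, ‖ω (τ i.1) a‖)) μ)
    {i j : Fin m} (hij : i ≠ j) (hτij : τ i ≠ j) :
    IndepFun (fun a => ‖ω i a‖) (fun a => ‖ω j a‖) μ := by
  have key : ∀ i : Fin m, ∃ (k : {i : Fin m // i ≤ τ i}) (φ : ℝ × ℝ → ℝ), Measurable φ ∧
      (fun a => ‖ω i a‖) = φ ∘ (fun a => (‖ω k.1 a‖, ‖ω (τ k.1) a‖)) ∧
      (k.1 = i ∨ k.1 = τ i) := by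
    intro i
    rcases le_total i (τ i) with h | h
    · exact ⟨⟨i, h⟩, Prod.fst, measurable_fst, rfl, Or.inl rfl⟩
    · refine ⟨⟨τ i, by rwa [hτ.involutive i]⟩, Prod.snd, measurable_snd, ?_, Or.inr rfl⟩
      ext a
      simp [hτ.involutive i]
  obtain ⟨k, φ, hφ, hk, hki⟩ := key i
  obtain ⟨l, ψ, hψ, hl, hlj⟩ := key j
  rw [hk, hl]
  refine (hind.indepFun ?_).comp hφ hψ
  rintro rfl
  have hinv := hτ.involutive
  rcases hki with h1 | h1 <;> rcases hlj with h2 | h2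
  · exact hij (h1.symm.trans h2)
  · exact hτij (by rw [← h1, h2, hinv j])
  · exact hτij (h1.symm.trans h2)
  · exact hij (hinv.injective (h1.symm.trans h2))

/-- The first two frequencies share an ensemble as `d ≥ 2`, so they are not both left over. This
pair makes the variance inequality strict. -/
lemma IsPairing.exists_ne {τ : Fin m → Fin m} (hτ : IsPairing d τ) (hd : 2 ≤ d) (hm : 2 ≤ m) :
    ∃ i, τ i ≠ i := by
  by_contra! h
  have := hτ.left_over ⟨0, by omega⟩ ⟨1, by omega⟩ (h _) (h _)
    (by simp [ensemble, Nat.div_eq_of_lt (show 1 < d by omega)])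
  simp at this

lemma IsOrthogonal.map_norms_eq_prod [IsProbabilityMeasure μ] (hω : IsOrthogonal μ ω)
    {i j : Fin m} (hind : IndepFun (fun a => ‖ω i a‖) (fun a => ‖ω j a‖) μ) :
    μ.map (fun a => (‖ω i a‖, ‖ω j a‖)) = (chi d).prod (chi d) := by
  rw [hind.map_prod_eq_prod_map_map (hω.measurable i).norm.aemeasurable
    (hω.measurable j).norm.aemeasurable, hω.norm_law i, hω.norm_law j]

lemma IsOrthogonal.isNormCoupling (hω : IsOrthogonal μ ω) {i j : Fin m}
    (h : ∀ᵐ a ∂μ, cdf (chi d) ‖ω i a‖ + cdf (chi d) ‖ω j a‖ = 1) :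
    IsNormCoupling d (μ.map fun a => (‖ω i a‖, ‖ω j a‖)) := by
  have hi := (hω.measurable i).norm
  have hj := (hω.measurable j).norm
  have hF : Measurable (cdf (chi d)) := (monotone_cdf _).measurable
  refine ⟨?_, ?_, ?_⟩
  · rw [Measure.map_map measurable_fst (hi.prodMk hj)]
    exact hω.norm_law i
  · rw [Measure.map_map measurable_snd (hi.prodMk hj)]
    exact hω.norm_law j
  · rwa [ae_map_iff (hi.prodMk hj).aemeasurable
      (measurableSet_eq_fun (by fun_prop) measurable_const)]

/-- If the mixed moments of the projections `h ⟨ω i, v⟩` within an ensemble are the means of a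
function `K` of the norms, and if coupling the norms decreases the mean of `K`, then coupling the
norms decreases the variance. -/
theorem IsPNC.variance_sum_lt [IsProbabilityMeasure μ] [IsProbabilityMeasure μ'] [NeZero d]
    (hω : IsPNC μ ω) (hω' : IsOrthogonalIndepNorms μ' ω') (hd : 2 ≤ d) (hm : 2 ≤ m)
    {h : ℝ → ℝ} (hh : Continuous h) (v : EuclideanSpace ℝ (Fin d))
    (hL : ∀ i, MemLp (fun a => h (inner ℝ (ω i a) v)) 2 μ)
    (hL' : ∀ i, MemLp (fun a => h (inner ℝ (ω' i a) v)) 2 μ') {K : ℝ × ℝ → ℝ}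
    (hK : ∀ i j, i ≠ j → ensemble d i = ensemble d j →
      ∫ a, h (inner ℝ (ω i a) v) * h (inner ℝ (ω j a) v) ∂μ =
        ∫ p, K p ∂(μ.map fun a => (‖ω i a‖, ‖ω j a‖)))
    (hK' : ∀ i j, i ≠ j → ensemble d i = ensemble d j →
      ∫ a, h (inner ℝ (ω' i a) v) * h (inner ℝ (ω' j a) v) ∂μ' =
        ∫ p, K p ∂(μ'.map fun a => (‖ω' i a‖, ‖ω' j a‖)))
    (hlt : ∀ N, IsNormCoupling d N → ∫ p, K p ∂N < ∫ p, K p ∂((chi d).prod (chi d))) :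
    Var[fun a => ∑ i, h (inner ℝ (ω i a) v); μ] < Var[fun a => ∑ i, h (inner ℝ (ω' i a) v); μ'] := by
  obtain ⟨hO, τ, hτ, hcdf, hind⟩ := hω
  obtain ⟨hO', hind'⟩ := hω'
  have hmean : ∀ i, ∫ a, h (inner ℝ (ω i a) v) ∂μ = ∫ a, h (inner ℝ (ω' i a) v) ∂μ' := by
    intro i
    rw [hO.integral_comp_inner_single hd i hh v ((hL i).integrable one_le_two),
      hO'.integral_comp_inner_single hd i hh v ((hL' i).integrable one_le_two)]
  have hpair : ∀ i j, i ≠ j → τ i = j →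
      cov[fun a => h (inner ℝ (ω i a) v), fun a => h (inner ℝ (ω j a) v); μ] <
        cov[fun a => h (inner ℝ (ω' i a) v), fun a => h (inner ℝ (ω' j a) v); μ'] := by
    rintro i j hij rfl
    have he := (hτ.same_ensemble i).symm
    rw [covariance_eq_sub (hL i) (hL _), covariance_eq_sub (hL' i) (hL' _), hmean, hmean]
    refine sub_lt_sub_right ?_ _
    have h1 := hK i _ hij he
    have h2 := hK' i _ hij he
    rw [hO'.map_norms_eq_prod (hind'.indepFun hij)] at h2
    simp only [Pi.mul_apply]
    rw [h1, h2]
    exact hlt _ (hO.isNormCoupling (hcdf i hij.symm))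
  have hle : ∀ i j, cov[fun a => h (inner ℝ (ω i a) v), fun a => h (inner ℝ (ω j a) v); μ] ≤
        cov[fun a => h (inner ℝ (ω' i a) v), fun a => h (inner ℝ (ω' j a) v); μ'] := by
    intro i j
    by_cases hij : i = j
    · subst hij
      rw [covariance_eq_sub (hL i) (hL _), covariance_eq_sub (hL' i) (hL' _), hmean]
      refine le_of_eq (congrArg (· - _) ?_)
      -- The diagonal second moments agree by the single-frequency formula applied to `h ^ 2`.
      simp only [Pi.mul_apply, ← sq]
      rw [hO.integral_comp_inner_single (h := fun x => h x ^ 2) hd i (by fun_prop) v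
          (hL i).integrable_sq,
        hO'.integral_comp_inner_single (h := fun x => h x ^ 2) hd i (by fun_prop) v
          (hL' i).integrable_sq]
    by_cases hτij : τ i = j
    · exact (hpair i j hij hτij).le
    have hI := hτ.indepFun_norm hind hij hτij
    have hI' := hind'.indepFun hij
    by_cases he : ensemble d i = ensemble d j
    · rw [covariance_eq_sub (hL i) (hL _), covariance_eq_sub (hL' i) (hL' _), hmean, hmean]
      refine le_of_eq (congrArg (· - _) ?_)
      simp only [Pi.mul_apply]
      rw [hK i j hij he, hK' i j hij he, hO.map_norms_eq_prod hI, hO'.map_norms_eq_prod hI']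
    · rw [hO.covariance_eq_zero he hI hh v hL, hO'.covariance_eq_zero he hI' hh v hL']
  obtain ⟨i, hi⟩ := hτ.exists_ne hd hm
  rw [variance_fun_sum hL, variance_fun_sum hL']
  exact Finset.sum_lt_sum (fun i _ => Finset.sum_le_sum fun j _ => hle i j)
    ⟨i, Finset.mem_univ i, Finset.sum_lt_sum (fun j _ => hle i j)
      ⟨τ i, Finset.mem_univ _, hpair i (τ i) hi.symm rfl⟩⟩

namespace IsOrthogonal

variable [IsProbabilityMeasure μ] [NeZero d]

lemma integral_exp_mul_exp (hω : IsOrthogonal μ ω) (hd : 2 ≤ d) (v : EuclideanSpace ℝ (Fin d))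
    {i j : Fin m} (hij : i ≠ j) (he : ensemble d i = ensemble d j) :
    ∫ a, Real.exp (inner ℝ (ω i a) v) * Real.exp (inner ℝ (ω j a) v) ∂μ =
      ∫ p, sphereMean d Real.exp (√(p.1 ^ 2 + p.2 ^ 2) * ‖v‖)
        ∂(μ.map fun a => (‖ω i a‖, ‖ω j a‖)) := by
  have hint := (hω.memLp_exp_inner i v).integrable_mul (hω.memLp_exp_inner j v)
  have hE : ∀ a, Real.exp (inner ℝ (ω i a) v) * Real.exp (inner ℝ (ω j a) v) =
      Real.exp (inner ℝ (ω i a + (1 : ℝ) • ω j a) v) := by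
    intro a
    rw [← Real.exp_add, one_smul, inner_add_left]
  rw [← hω.integral_comp_inner_pair hd hij he (one_pow 2) Real.continuous_exp v]
  · simp only [hE]
  · exact hint.congr (ae_of_all _ hE)

/-- The product formula brings in `ω i + ω j` and `ω i - ω j`, which contribute equal means because
their norms coincide. -/
lemma integral_cos_mul_cos (hω : IsOrthogonal μ ω) (hd : 2 ≤ d) (v : EuclideanSpace ℝ (Fin d))
    {i j : Fin m} (hij : i ≠ j) (he : ensemble d i = ensemble d j) :
    ∫ a, Real.cos (inner ℝ (ω i a) v) * Real.cos (inner ℝ (ω j a) v) ∂μ =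
      ∫ p, sphereMean d Real.cos (√(p.1 ^ 2 + p.2 ^ 2) * ‖v‖)
        ∂(μ.map fun a => (‖ω i a‖, ‖ω j a‖)) := by
  have hmi := hω.measurable i
  have hmj := hω.measurable j
  have hint : ∀ σ : ℝ, Integrable (fun a => Real.cos (inner ℝ (ω i a + σ • ω j a) v)) μ :=
    fun σ => Integrable.of_bound (C := 1) (Measurable.aestronglyMeasurable (by fun_prop))
      (ae_of_all _ fun a => Real.abs_cos_le_one _)
  have hE : ∀ a, Real.cos (inner ℝ (ω i a) v) * Real.cos (inner ℝ (ω j a) v) =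
      (Real.cos (inner ℝ (ω i a + (1 : ℝ) • ω j a) v) +
        Real.cos (inner ℝ (ω i a + (-1 : ℝ) • ω j a) v)) / 2 := by
    intro a
    rw [one_smul, neg_one_smul, inner_add_left, inner_add_left, inner_neg_left, Real.cos_add,
      Real.cos_add, Real.cos_neg, Real.sin_neg]
    ring
  simp only [hE]
  rw [integral_div, integral_add (hint 1) (hint (-1)),
    hω.integral_comp_inner_pair hd hij he (one_pow 2) Real.continuous_cos v (hint 1),
    hω.integral_comp_inner_pair hd hij he (by norm_num) Real.continuous_cos v (hint (-1))]
  ring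

end IsOrthogonal

end comparison

/-! ### The estimators as sums over projections, and the conclusion. -/

lemma rlfEstimator_eq {d m : ℕ} (x y : EuclideanSpace ℝ (Fin d))
    (w : Fin m → EuclideanSpace ℝ (Fin d)) :
    rlfEstimator x y w = 1 / m * Real.exp (-‖x‖ ^ 2 - ‖y‖ ^ 2) *
      ∑ i, Real.exp (inner ℝ (w i) (x + y)) := by
  have hsq : √(1 / (m : ℝ)) * √(1 / (m : ℝ)) = 1 / m := Real.mul_self_sqrt (by positivity)
  simp only [rlfEstimator, rlfFeatures, dotProduct, Finset.mul_sum]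
  refine Finset.sum_congr rfl fun i _ => ?_
  rw [inner_add_right, Real.exp_add, sub_eq_add_neg, Real.exp_add]
  linear_combination Real.exp (-‖x‖ ^ 2) * Real.exp (-‖y‖ ^ 2) * Real.exp (inner ℝ (w i) x) *
    Real.exp (inner ℝ (w i) y) * hsq

lemma rffEstimator_eq {d m : ℕ} (x y : EuclideanSpace ℝ (Fin d))
    (w : Fin m → EuclideanSpace ℝ (Fin d)) :
    rffEstimator x y w = 1 / m * ∑ i, Real.cos (inner ℝ (w i) (x - y)) := by
  have hsq : √(1 / (m : ℝ)) * √(1 / (m : ℝ)) = 1 / m := Real.mul_self_sqrt (by positivity)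
  simp only [rffEstimator, rffFeatures, dotProduct, Finset.mul_sum, Fintype.sum_prod_type]
  refine Finset.sum_congr rfl fun i _ => ?_
  rw [inner_sub_right, Real.cos_sub, ← hsq]
  simp
  ring

end

theorem corollary1 (d : ℕ) (hd : 2 ≤ d) :
    (∀ (m : ℕ), 2 ≤ m →
      ∀ (Ω : Type*) [MeasurableSpace Ω] (μ : Measure Ω) [IsProbabilityMeasure μ]
        (ω : Fin m → Ω → EuclideanSpace ℝ (Fin d)), IsPNC μ ω →
      ∀ (Ω' : Type*) [MeasurableSpace Ω'] (μ' : Measure Ω') [IsProbabilityMeasure μ']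
        (ω' : Fin m → Ω' → EuclideanSpace ℝ (Fin d)), IsOrthogonalIndepNorms μ' ω' →
      ∀ x y : EuclideanSpace ℝ (Fin d),
        MemLp (fun a => rlfEstimator x y (fun i => ω i a)) 2 μ ∧
        MemLp (fun a => rlfEstimator x y (fun i => ω' i a)) 2 μ' ∧
        (x + y ≠ 0 →
          variance (fun a => rlfEstimator x y (fun i => ω i a)) μ <
            variance (fun a => rlfEstimator x y (fun i => ω' i a)) μ')) ∧
    (∃ δ : ℝ, 0 < δ ∧ ∀ (m : ℕ), 2 ≤ m →
      ∀ (Ω : Type*) [MeasurableSpace Ω] (μ : Measure Ω) [IsProbabilityMeasure μ]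
        (ω : Fin m → Ω → EuclideanSpace ℝ (Fin d)), IsPNC μ ω →
      ∀ (Ω' : Type*) [MeasurableSpace Ω'] (μ' : Measure Ω') [IsProbabilityMeasure μ']
        (ω' : Fin m → Ω' → EuclideanSpace ℝ (Fin d)), IsOrthogonalIndepNorms μ' ω' →
      ∀ x y : EuclideanSpace ℝ (Fin d), 0 < ‖x - y‖ → ‖x - y‖ < δ →
        MemLp (fun a => rffEstimator x y (fun i => ω i a)) 2 μ ∧
        MemLp (fun a => rffEstimator x y (fun i => ω' i a)) 2 μ' ∧
        variance (fun a => rffEstimator x y (fun i => ω i a)) μ <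
          variance (fun a => rffEstimator x y (fun i => ω' i a)) μ') := by
  have : NeZero d := ⟨by omega⟩
  constructor
  · intro m hm Ω _ μ _ ω hω Ω' _ μ' _ ω' hω' x y
    have hL := fun i => hω.isOrthogonal.memLp_exp_inner i (x + y)
    have hL' := fun i => hω'.isOrthogonal.memLp_exp_inner i (x + y)
    simp only [rlfEstimator_eq]
    refine ⟨(memLp_finsetSum _ fun i _ => hL i).const_mul _,
      (memLp_finsetSum _ fun i _ => hL' i).const_mul _, fun hxy => ?_⟩
    rw [variance_const_mul, variance_const_mul]
    have hm0 : (0 : ℝ) < m := by positivity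
    gcongr
    exact hω.variance_sum_lt hω' hd hm Real.continuous_exp (x + y) hL hL'
      (fun i j => hω.isOrthogonal.integral_exp_mul_exp hd (x + y))
      (fun i j => hω'.isOrthogonal.integral_exp_mul_exp hd (x + y))
      fun N hN => hN.integral_sphereMean_exp_lt (by omega) (norm_pos_iff.2 hxy)
  -- `δ` is fixed before `m` and the frequencies enter, hence depends on `d` alone.
  · obtain ⟨δ, hδ, hlt⟩ := exists_integral_sphereMean_cos_lt (d := d) (by omega)
    refine ⟨δ, hδ, ?_⟩
    intro m hm Ω _ μ _ ω hω Ω' _ μ' _ ω' hω' x y hxy hxyδ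
    have hL := fun i => hω.isOrthogonal.memLp_cos_inner i (x - y)
    have hL' := fun i => hω'.isOrthogonal.memLp_cos_inner i (x - y)
    simp only [rffEstimator_eq]
    refine ⟨(memLp_finsetSum _ fun i _ => hL i).const_mul _,
      (memLp_finsetSum _ fun i _ => hL' i).const_mul _, ?_⟩
    rw [variance_const_mul, variance_const_mul]
    have hm0 : (0 : ℝ) < m := by positivity
    gcongr
    exact hω.variance_sum_lt hω' hd hm Real.continuous_cos (x - y) hL hL'
      (fun i j => hω.isOrthogonal.integral_cos_mul_cos hd (x - y))
      (fun i j => hω'.isOrthogonal.integral_cos_mul_cos hd (x - y))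
      fun N hN => hlt N hN _ hxy hxyδ
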